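/- Let $n\ge 2$, let $F_n$ be the free group of rank $n$ and let $\partial F_n$ be its Gromov boundary with the Cantor topology. The space of lines $\mathcal B$ is the quotient of $\partial F_n\times\partial F_n-\Delta$ ($\Delta$ the diagonal) by the interchange of the two factors and by the diagonal action of $F_n$; its quotient topology is called the weak topology. A pair $(\xi,\eta)$ that projects to $\ell\in\mathcal B$ is a lift of $\ell$. For subgroups $A\le H$ of $F_n$, $A$ is a free factor of $H$ if $H=A*C$ for some subgroup $C$; it is proper if $A\neq H$. A free factor system is a finite set $\mathcal A=\{[A_1],\dots,[A_k]\}$ of conjugacy classes of nontrivial finite rank subgroups of $F_n$ for which there is a free factorization $F_n=A_1*\cdots*A_k*B$, with $B$ possibly trivial. One writes $\mathcal A\sqsubset\mathcal A'$ if each subgroup $A$ with $[A]\in\mathcal A$ is a free factor of some subgroup $A'$ with $[A']\in\mathcal A'$; the meet of a collection of free factor systems is the greatest free factor system that is $\sqsubset$ every member of the collection. A set $\mathcal A$ of conjugacy classes of subgroups carries a line $\ell$ if there are $[A]\in\mathcal A$ and a lift $(\xi,\eta)$ of $\ell$ with $\xi,\eta\in\partial A$, where $\partial A\subset\partial F_n$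 is the set of accumulation points of $A$. A set $B\subset\mathcal B$ is filling if its free factor support, the meet of all free factor systems that carry every line of $B$, is $\{[F_n]\}$. Proposition. Let $B_1,B_2\subset\mathcal B$ be filling sets of lines whose weak closures satisfy $\mathrm{cl}(B_1)\cap \mathrm{cl}(B_2)=\emptyset$. Then there exist weak neighborhoods $U(b)\subset\mathcal B$ of $b$, one for each $b\in B_1\cup B_2$, such that for each proper free factor $F$ of $F_n$ there exists $b_F\in B_1\cup B_2$ such that $\{[F]\}$ does not carry any line in $U(b_F)$. -/

import Mathlib

namespace FreeLines

/-! ### The boundary of the free group of rank `n` -/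

/-- The letters `E_i` (as `(i, true)`) and their inverses (as `(i, false)`), with the convention of
`FreeGroup.toWord`. -/
abbrev Letter (n : ℕ) : Type := Fin n × Bool

/-- The inverse letter. -/
def Letter.inv {n : ℕ} (s : Letter n) : Letter n := (s.1, !s.2)

theorem Letter.inv_inv {n : ℕ} (s : Letter n) : s.inv.inv = s := by
  simp [Letter.inv]

/-- The boundary `∂F_n`: infinite reduced words in the letters, that is, the rays from the base
vertex of the universal cover of the rose, that is, the ends of that tree. As a subtype of a
product of finite discrete spaces it carries the usual Cantor topology. -/
abbrev Boundary (n : ℕ) : Type :=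
  {w : ℕ → Letter n // ∀ i, w (i + 1) ≠ (w i).inv}

/-- Left multiplication of an infinite reduced word by one letter, followed by reduction. -/
def letterMul {n : ℕ} (s : Letter n) (w : Boundary n) : Boundary n :=
  if h : w.1 0 = s.inv then
    ⟨fun i => w.1 (i + 1), fun i => w.2 (i + 1)⟩
  else
    ⟨fun i => Nat.casesOn i s w.1, fun i => by
      cases i with
      | zero => exact h
      | succ j => exact w.2 j⟩

theorem letterMul_inv {n : ℕ} (s : Letter n) (w : Boundary n) :
    letterMul s.inv (letterMul s w) = w := by
  by_cases h : w.1 0 = s.inv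
  · have h1 : w.1 1 ≠ s := by
      have := w.2 0
      rwa [h, Letter.inv_inv] at this
    apply Subtype.ext
    funext i
    cases i with
    | zero => simp [letterMul, h, Letter.inv_inv, h1]
    | succ j => simp [letterMul, h, Letter.inv_inv, h1]
  · apply Subtype.ext
    funext i
    simp [letterMul, h, Letter.inv_inv]

/-- Multiplication by the `x`-th generator as a permutation of the boundary. -/
def generatorPerm {n : ℕ} (x : Fin n) : Equiv.Perm (Boundary n) where
  toFun := letterMul (x, true)
  invFun := letterMul (x, false)
  left_inv w := letterMul_inv (x, true) w
  right_inv w := letterMul_inv (x, false) w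

/-- The action of `F_n` on `∂F_n`, extending left multiplication. -/
instance boundaryAction (n : ℕ) : MulAction (FreeGroup (Fin n)) (Boundary n) :=
  MulAction.compHom (Boundary n) (FreeGroup.lift (generatorPerm (n := n)))

/-- The boundary `∂A ⊆ ∂F_n` of a subgroup: the accumulation points in `∂F_n` of the orbit of the
base vertex, so `ξ ∈ ∂A` iff every finite prefix of `ξ` is a prefix of some element of `A`. -/
def boundaryOf {n : ℕ} (A : Subgroup (FreeGroup (Fin n))) : Set (Boundary n) :=
  {ξ | ∀ m : ℕ, ∃ a ∈ A, List.ofFn (fun i : Fin m => ξ.1 i) <+: a.toWord}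

/-! ### Lines and the weak topology -/

/-- Ordered pairs of distinct boundary points, `∂F_n × ∂F_n - Δ`, with the subspace topology. -/
abbrev EndpointPair (n : ℕ) : Type := {p : Boundary n × Boundary n // p.1 ≠ p.2}

/-- The orbit relation of the commuting actions of `F_n` (diagonal) and of `ℤ/2` (interchange of
the two factors) on `∂F_n × ∂F_n - Δ`. -/
def lineSetoid (n : ℕ) : Setoid (EndpointPair n) where
  r p q := ∃ g : FreeGroup (Fin n), g • p.1 = q.1 ∨ g • p.1 = q.1.swap
  iseqv :=
    { refl := fun p => ⟨1, Or.inl (one_smul _ _)⟩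
      symm := by
        rintro p q ⟨g, h | h⟩
        · exact ⟨g⁻¹, Or.inl (by rw [← h, inv_smul_smul])⟩
        · refine ⟨g⁻¹, Or.inr ?_⟩
          have h' : q.1 = g • p.1.swap := by
            rw [← Prod.swap_swap q.1, ← h]; rfl
          rw [h', inv_smul_smul]
      trans := by
        rintro p q r ⟨g, h⟩ ⟨k, h'⟩
        refine ⟨k * g, ?_⟩
        have hs : ∀ x : Boundary n × Boundary n, k • x.swap = (k • x).swap := fun _ => rfl
        rcases h with h | h <;> rcases h' with h' | h' <;>
          simp [mul_smul, h, h', hs] }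

/-- The space `𝓑` of lines of `F_n`: the quotient of `∂F_n × ∂F_n - Δ` by `ℤ/2` and `F_n`. -/
def Line (n : ℕ) : Type := Quotient (lineSetoid n)

/-- The weak topology: the quotient topology on the space of lines. -/
instance lineTopology (n : ℕ) : TopologicalSpace (Line n) :=
  inferInstanceAs (TopologicalSpace (Quotient (lineSetoid n)))

/-- The line with a given lift. -/
def Line.mk {n : ℕ} (p : EndpointPair n) : Line n := Quotient.mk (lineSetoid n) p

/-! ### Free factorizations and subgroup systems -/

section Systems

open scoped Pointwise

variable {G : Type*} [Group G]

/-- `H = ⁎ᵢ A i` as an internal free product of subgroups of `G`. -/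
def IsFreeFactorization {ι : Type*} (H : Subgroup G) (A : ι → Subgroup G) : Prop :=
  Function.Injective (Monoid.CoprodI.lift fun i => (A i).subtype) ∧
    (Monoid.CoprodI.lift fun i => (A i).subtype).range = H

/-- `A` is a free factor of `H`: `H = A * C` for some subgroup `C`. -/
def IsFreeFactor (A H : Subgroup G) : Prop :=
  ∃ C : Subgroup G, IsFreeFactorization H ![A, C]

/-- Conjugacy classes of subgroups of `G`. -/
def SubgroupClass (G : Type*) [Group G] : Type _ :=
  MulAction.orbitRel.Quotient (ConjAct G) (Subgroup G)

/-- The conjugacy class `[A]`. -/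
def conjClass (A : Subgroup G) : SubgroupClass G :=
  Quotient.mk (MulAction.orbitRel (ConjAct G) (Subgroup G)) A

/-- A subgroup system: a finite set of conjugacy classes of nontrivial subgroups of finite rank. -/
def IsSubgroupSystem (𝒜 : Set (SubgroupClass G)) : Prop :=
  𝒜.Finite ∧ ∀ A : Subgroup G, conjClass A ∈ 𝒜 → A ≠ ⊥ ∧ A.FG

/-- A free factor system: a subgroup system `{[A₁], …, [A_k]}` such that
`G = A₁ * ⋯ * A_k * B` for some (possibly trivial) subgroup `B`. -/
def IsFreeFactorSystem (𝒜 : Set (SubgroupClass G)) : Prop :=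
  IsSubgroupSystem 𝒜 ∧ ∃ (k : ℕ) (A : Fin k → Subgroup G) (B : Subgroup G),
    𝒜 = Set.range (fun i => conjClass (A i)) ∧
      IsFreeFactorization (⊤ : Subgroup G) (Fin.snoc (α := fun _ => Subgroup G) A B)

/-- The partial order `𝒜 ⊏ 𝒜'`. -/
def SystemLE (𝒜 𝒜' : Set (SubgroupClass G)) : Prop :=
  ∀ A : Subgroup G, conjClass A ∈ 𝒜 → ∃ A' : Subgroup G, conjClass A' ∈ 𝒜' ∧ IsFreeFactor A A'

/-- `𝒜` is the meet of the collection `𝒞` of free factor systems: the greatest free factor system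
that is `⊏` every member of `𝒞`. -/
def IsMeet (𝒞 : Set (Set (SubgroupClass G))) (𝒜 : Set (SubgroupClass G)) : Prop :=
  IsFreeFactorSystem 𝒜 ∧ (∀ 𝒜' ∈ 𝒞, SystemLE 𝒜 𝒜') ∧
    ∀ 𝒟 : Set (SubgroupClass G), IsFreeFactorSystem 𝒟 → (∀ 𝒜' ∈ 𝒞, SystemLE 𝒟 𝒜') → SystemLE 𝒟 𝒜

end Systems

/-! ### Carrying and filling -/

/-- `𝒜` carries `ℓ`: there are `[A] ∈ 𝒜` and a lift of `ℓ` with both endpoints in `∂A`. -/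
def Carries {n : ℕ} (𝒜 : Set (SubgroupClass (FreeGroup (Fin n)))) (ℓ : Line n) : Prop :=
  ∃ A : Subgroup (FreeGroup (Fin n)), conjClass A ∈ 𝒜 ∧
    ∃ p : EndpointPair n, Line.mk p = ℓ ∧ p.1.1 ∈ boundaryOf A ∧ p.1.2 ∈ boundaryOf A

/-- `𝒜` is the free factor support of the set `B` of lines: the meet of all free factor systems
that carry every line of `B`. -/
def IsFreeFactorSupport {n : ℕ} (B : Set (Line n))
    (𝒜 : Set (SubgroupClass (FreeGroup (Fin n)))) : Prop :=
  IsMeet {𝒜' | IsFreeFactorSystem 𝒜' ∧ ∀ ℓ ∈ B, Carries 𝒜' ℓ} 𝒜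

/-- `B` is filling: its free factor support is `{[F_n]}`. -/
def IsFilling {n : ℕ} (B : Set (Line n)) : Prop :=
  IsFreeFactorSupport B {conjClass ⊤}

end FreeLines

/-! The proof refines the rose until the lines of `B₁ ∪ B₂` turn enough at every vertex. A
resolution is a finite graph with edges labelled by letters, whose cover `Vert n V` over the Cayley
tree is again a tree with free `F_n`-action, together with lifts of the lines that jointly visit
every vertex. A direction `x` at a vertex is a cut direction if the other directions fall into two
nonempty sets between which no line turns. One can then unfold: divide the vertex in two, give each
half its share of the directions and a copy of `x`. The cover remains a tree, the lines still lift,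
and there is one more vertex and at most one more edge.

Unfolding must stop. If a filling set crossed some edge orbit in no line, collapsing all other edges
would give a free splitting whose vertex groups form a free factor system that carries the set and
omits `[F_n]` (`LineMap.crosses_of_isFilling`). So both `B₁` and `B₂` cross every edge. Vertices
have valence at least two and edges minus vertices is at most `n - 1`, so the number of branch
vertices is bounded, and a large resolution has a vertex far from all of them. Lines of `B₁` and of
`B₂` through it agree on a long segment (`Resolution.exists_agree`); by compactness the weak
closures would meet (`closure_inter_nonempty`). Hence some resolution has no cut direction
(`exists_noCut`).

Let `U(b)` consist of the lines that have, for each turn of `b` in this resolution, a lift with its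
ends in the two half spaces of the turn. Suppose a proper free factor `F ≠ 1` carries a line of
every `U(b)`, and write `F_n = F * C`. The base edge of the Bass-Serre tree of this splitting yields
an almost invariant set `P` (`exists_almostInvariant`), none of whose translates separates the ends
of a line carried by `F` (`endsIn_of_mem_boundaryOf`). These lines realize all turns, and without
cut directions this forces `P` to contain all ends or none (`Resolution.NoCut.endsIn_iff`). But long
elements of `C` give an end in `P`, and long elements of `F` one outside. -/

namespace FreeLines

variable {n : ℕ}

/-! ### Letters, prefixes and the action on the boundary -/

/-- The group element of a letter. -/
def gen (s : Letter n) : FreeGroup (Fin n) := FreeGroup.mk [s]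

theorem gen_inv (s : Letter n) : gen s.inv = (gen s)⁻¹ := by
  simp [gen, Letter.inv, FreeGroup.inv_mk, FreeGroup.invRev]

theorem Letter.inv_ne (s : Letter n) : s.inv ≠ s := by
  intro h
  have := congrArg Prod.snd h
  simp [Letter.inv] at this

theorem gen_injective : Function.Injective (gen : Letter n → FreeGroup (Fin n)) := by
  intro s t h
  have := congrArg FreeGroup.toWord h
  simpa [gen] using this

theorem gen_ne_one (s : Letter n) : gen s ≠ 1 := by
  intro h
  have := congrArg FreeGroup.toWord h
  simp [gen] at this

theorem gen_smul (s : Letter n) (ξ : Boundary n) : gen s • ξ = letterMul s ξ := by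
  obtain ⟨x, b⟩ := s
  have key : ∀ g : FreeGroup (Fin n), g • ξ = FreeGroup.lift (generatorPerm (n := n)) g ξ :=
    fun _ => rfl
  cases b with
  | true => rw [key, gen, ← FreeGroup.of, FreeGroup.lift_apply_of]; rfl
  | false =>
    have h : gen (x, false) = (FreeGroup.of x)⁻¹ := gen_inv (x, true)
    rw [key, h, map_inv, FreeGroup.lift_apply_of]; rfl

/-- A subset of the free group that contains `1` and is stable under right multiplication by
letters is everything. -/
theorem gen_induction {p : FreeGroup (Fin n) → Prop} (h1 : p 1)
    (hmul : ∀ g s, p g → p (g * gen s)) (g : FreeGroup (Fin n)) : p g := by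
  have : ∀ L : List (Letter n), p (FreeGroup.mk L) := by
    intro L
    induction L using List.reverseRecOn with
    | nil => exact h1
    | append_singleton L s ih => rw [← FreeGroup.mul_mk]; exact hmul _ _ ih
  rw [← FreeGroup.mk_toWord (x := g)]
  exact this _

/-- The vertex reached after `m` letters of the ray `ξ`. -/
def pre (ξ : Boundary n) (m : ℕ) : FreeGroup (Fin n) :=
  FreeGroup.mk (List.ofFn fun i : Fin m => ξ.1 i)

@[simp] theorem pre_zero (ξ : Boundary n) : pre ξ 0 = 1 := rfl

theorem pre_succ (ξ : Boundary n) (m : ℕ) : pre ξ (m + 1) = pre ξ m * gen (ξ.1 m) := by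
  rw [pre, List.ofFn_succ', List.concat_eq_append, ← FreeGroup.mul_mk]
  rfl

theorem pre_one (ξ : Boundary n) : pre ξ 1 = gen (ξ.1 0) := by
  simp [pre_succ]

theorem isReduced_ofFn (ξ : Boundary n) (m : ℕ) :
    FreeGroup.IsReduced (List.ofFn fun i : Fin m => ξ.1 i) := by
  rw [FreeGroup.IsReduced, List.isChain_iff_getElem]
  intro i hi h
  simp only [List.getElem_ofFn] at h ⊢
  have h2 := ξ.2 i
  by_contra h3
  apply h2
  refine Prod.ext h.symm ?_
  simp only [Letter.inv]
  cases ha : (ξ.1 i).2 <;> cases hb : (ξ.1 (i + 1)).2 <;> simp_all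

theorem toWord_pre (ξ : Boundary n) (m : ℕ) :
    (pre ξ m).toWord = List.ofFn fun i : Fin m => ξ.1 i := by
  rw [pre, FreeGroup.toWord_mk]
  exact (isReduced_ofFn ξ m).reduce_eq

theorem norm_pre (ξ : Boundary n) (m : ℕ) : (pre ξ m).norm = m := by
  rw [FreeGroup.norm, toWord_pre]
  simp

theorem pre_injective (ξ : Boundary n) : Function.Injective (pre ξ) := fun i j h => by
  rw [← norm_pre ξ i, h, norm_pre]

theorem pre_congr {ξ η : Boundary n} {m : ℕ} (h : ∀ i < m, ξ.1 i = η.1 i) :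
    pre ξ m = pre η m := by
  unfold pre
  congr 2
  funext i
  exact h i i.2

theorem gen_inv_smul_apply (ξ : Boundary n) (i : ℕ) :
    ((gen (ξ.1 0))⁻¹ • ξ).1 i = ξ.1 (i + 1) := by
  rw [← gen_inv, gen_smul, letterMul, dif_pos (Letter.inv_inv _).symm]

theorem gen_inv_smul_apply_zero_of_ne {s : Letter n} {ξ : Boundary n} (h : ξ.1 0 ≠ s) :
    ((gen s)⁻¹ • ξ).1 0 = s.inv := by
  rw [← gen_inv, gen_smul, letterMul, dif_neg (by rwa [Letter.inv_inv])]
  rfl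

theorem pre_inv_smul_apply (ξ : Boundary n) (m i : ℕ) :
    ((pre ξ m)⁻¹ • ξ).1 i = ξ.1 (m + i) := by
  induction m generalizing i with
  | zero => simp
  | succ m ih =>
    have h0 : ξ.1 m = ((pre ξ m)⁻¹ • ξ).1 0 := by rw [ih]; rfl
    rw [pre_succ, mul_inv_rev, mul_smul, h0, gen_inv_smul_apply, ih]
    exact congrArg ξ.1 (by omega)

/-- The letter `s` either cancels the first letter of `ξ` or is put in front of it, which shifts the
index by one in one direction or the other. -/
theorem pre_smul_gen (s : Letter n) (ξ : Boundary n) :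
    (∀ i, pre (gen s • ξ) i = gen s * pre ξ (i + 1)) ∨
      ∀ i, pre (gen s • ξ) (i + 1) = gen s * pre ξ i := by
  by_cases h : ξ.1 0 = s.inv
  · left
    have hc : ∀ j, (gen s • ξ).1 j = ξ.1 (j + 1) := by
      intro j
      rw [gen_smul, letterMul, dif_pos h]
    intro i
    induction i with
    | zero => rw [pre_zero, zero_add, pre_one, h, gen_inv, mul_inv_cancel]
    | succ i ih => rw [pre_succ, ih, pre_succ ξ (i + 1), hc, mul_assoc]
  · right
    have hc : ∀ j, (gen s • ξ).1 (j + 1) = ξ.1 j := by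
      intro j
      rw [gen_smul, letterMul, dif_neg h]
    have hc0 : (gen s • ξ).1 0 = s := by
      rw [gen_smul, letterMul, dif_neg h]
      rfl
    intro i
    induction i with
    | zero => rw [zero_add, pre_one, hc0, pre_zero, mul_one]
    | succ i ih => rw [pre_succ, ih, pre_succ ξ i, hc, mul_assoc]

/-- The rays `g • ξ` and `g * pre ξ` eventually agree. -/
theorem exists_pre_smul (g : FreeGroup (Fin n)) (ξ : Boundary n) :
    ∃ j k, ∀ i, pre (g • ξ) (j + i) = g * pre ξ (k + i) := by
  induction g using gen_induction generalizing ξ with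
  | h1 => exact ⟨0, 0, fun i => by simp⟩
  | hmul g s ih =>
    obtain ⟨j, k, h⟩ := ih (gen s • ξ)
    rcases pre_smul_gen s ξ with h2 | h2
    · refine ⟨j, k + 1, fun i => ?_⟩
      rw [mul_smul, h, h2, mul_assoc]
      congr 3
      omega
    · refine ⟨j + 1, k, fun i => ?_⟩
      rw [mul_smul, show j + 1 + i = j + (i + 1) by omega, h,
        show k + (i + 1) = k + i + 1 by omega, h2, mul_assoc]

theorem continuous_letterMul (s : Letter n) : Continuous (letterMul s) := by
  refine Continuous.subtype_mk (f := fun w => (letterMul s w).1) ?_ _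
  refine continuous_pi fun i => ?_
  have hc : ∀ j, Continuous fun w : Boundary n => w.1 j := fun j =>
    (continuous_apply j).comp continuous_subtype_val
  -- A letter of the product depends only on three letters of `w`, hence is continuous. For `i = 0`
  -- the truncated index `i - 1` is harmless, since that branch returns `s`.
  have : (fun w : Boundary n => (letterMul s w).1 i) =
      (fun q : Letter n × Letter n × Letter n =>
        if q.1 = s.inv then q.2.1 else if i = 0 then s else q.2.2) ∘
      fun w => (w.1 0, w.1 (i + 1), w.1 (i - 1)) := by
    funext w
    by_cases h : w.1 0 = s.inv
    · simp [letterMul, h]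
    · cases i with
      | zero => simp [letterMul, h]
      | succ i => simp [letterMul, h]
  rw [this]
  exact continuous_of_discreteTopology.comp ((hc _).prodMk ((hc _).prodMk (hc _)))

instance : ContinuousConstSMul (FreeGroup (Fin n)) (Boundary n) where
  continuous_const_smul g := by
    induction g using gen_induction with
    | h1 => simp only [one_smul]; exact continuous_id
    | hmul g s ih =>
      simp only [mul_smul]
      have h : Continuous fun ξ : Boundary n => gen s • ξ := by
        simpa only [gen_smul] using continuous_letterMul s
      exact ih.comp h

instance : CompactSpace (Boundary n) := by
  have hcl : IsClosed {w : ℕ → Letter n | ∀ i, w (i + 1) ≠ (w i).inv} := by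
    rw [Set.ofPred_forall]
    refine isClosed_iInter fun i => ?_
    have hc : Continuous fun w : ℕ → Letter n => (w (i + 1), w i) :=
      (continuous_apply _).prodMk (continuous_apply _)
    exact (isClosed_discrete {q : Letter n × Letter n | q.1 ≠ q.2.inv}).preimage hc
  exact isCompact_iff_compactSpace.mp hcl.isCompact

theorem isOpen_cylinder (ξ : Boundary n) (N : ℕ) :
    IsOpen {ξ' : Boundary n | ∀ i < N, ξ'.1 i = ξ.1 i} := by
  have : {ξ' : Boundary n | ∀ i < N, ξ'.1 i = ξ.1 i} =
      ⋂ i ∈ Set.Iio N, {ξ' | ξ'.1 i = ξ.1 i} := by ext; simp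
  rw [this]
  refine (Set.finite_Iio N).isOpen_biInter fun i _ => ?_
  have hc : Continuous fun w : Boundary n => w.1 i :=
    (continuous_apply i).comp continuous_subtype_val
  exact (isOpen_discrete {ξ.1 i}).preimage hc

/-! ### Reduced words -/

theorem toWord_mul_gen (w : FreeGroup (Fin n)) (s : Letter n) :
    (w * gen s).toWord = w.toWord ++ [s] ∨ w.toWord = (w * gen s).toWord ++ [s.inv] := by
  have hw : FreeGroup.IsReduced w.toWord := FreeGroup.isReduced_toWord
  have hmul : w * gen s = FreeGroup.mk (w.toWord ++ [s]) := by
    rw [← FreeGroup.mul_mk, FreeGroup.mk_toWord, gen]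
  rcases List.eq_nil_or_concat w.toWord with h | ⟨L, t, h⟩
  · left
    rw [hmul, h]; simp
  · by_cases hts : t = s.inv
    · right
      have hL : FreeGroup.IsReduced L := by
        rw [h, List.concat_eq_append] at hw
        exact List.IsChain.left_of_append hw
      have : w * gen s = FreeGroup.mk L := by
        rw [← FreeGroup.mk_toWord (x := w), h, List.concat_eq_append, ← FreeGroup.mul_mk, hts,
          ← gen, gen_inv, inv_mul_cancel_right]
      rw [this, FreeGroup.toWord_mk, hL.reduce_eq, h, hts, List.concat_eq_append]
    · left
      rw [hmul, FreeGroup.toWord_mk]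
      refine FreeGroup.IsReduced.reduce_eq ?_
      have h2 : FreeGroup.IsReduced ([t] ++ [s]) := by
        simp only [List.cons_append, List.nil_append, FreeGroup.isReduced_cons_cons,
          FreeGroup.IsReduced.singleton, and_true]
        intro h3
        by_contra h4
        refine hts (Prod.ext h3 ?_)
        simp only [Letter.inv]
        cases ha : t.2 <;> cases hb : s.2 <;> simp_all
      rw [h, List.concat_eq_append] at hw ⊢
      exact FreeGroup.IsReduced.append_overlap hw h2 (by simp)

/-- Each letter of `r` cancels at most one letter at the end of `w`, so the first `w.norm - r.norm`
letters survive. -/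
theorem prefix_toWord_mul (w r : FreeGroup (Fin n)) (l : List (Letter n)) (hl : l <+: w.toWord)
    (h : l.length + r.norm ≤ w.norm) : l <+: (w * r).toWord := by
  have key : ∀ (R : List (Letter n)) (w : FreeGroup (Fin n)), l <+: w.toWord →
      l.length + R.length ≤ w.toWord.length → l <+: (w * FreeGroup.mk R).toWord := by
    intro R
    induction R with
    | nil => intro w h1 _; simpa [← FreeGroup.one_eq_mk] using h1
    | cons s R ih =>
      intro w h1 h2
      have : w * FreeGroup.mk (s :: R) = (w * gen s) * FreeGroup.mk R := by
        rw [mul_assoc, gen, FreeGroup.mul_mk]; rfl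
      rw [this]
      simp only [List.length_cons] at h2
      rcases toWord_mul_gen w s with h3 | h3
      · refine ih _ ?_ ?_
        · rw [h3]; exact h1.trans (List.prefix_append _ _)
        · rw [h3]; simp; omega
      · have h4 := congrArg List.length h3
        simp only [List.length_append, List.length_singleton] at h4
        refine ih _ ?_ (by omega)
        rw [h3] at h1
        exact List.prefix_of_prefix_length_le h1 (List.prefix_append _ _) (by omega)
  have := key r.toWord w hl h
  rwa [FreeGroup.mk_toWord] at this

end FreeLines

namespace FreeLines

open Filter

variable {n : ℕ} {V : Type}

/-! ### Trees with a free action of the free group -/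

/-- Vertices of a tree over the Cayley tree of `F_n`: the fibre over each vertex is `V`. -/
abbrev Vert (n : ℕ) (V : Type) : Type := FreeGroup (Fin n) × V

/-- The translation action of `F_n` on vertices. -/
def tr (g : FreeGroup (Fin n)) (z : Vert n V) : Vert n V := (g * z.1, z.2)

@[simp] theorem tr_one (z : Vert n V) : tr 1 z = z := by simp [tr]

theorem tr_tr (g h : FreeGroup (Fin n)) (z : Vert n V) : tr g (tr h z) = tr (g * h) z := by
  simp [tr, mul_assoc]

@[simp] theorem tr_inv_tr (g : FreeGroup (Fin n)) (z : Vert n V) : tr g⁻¹ (tr g z) = z := by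
  simp [tr]

@[simp] theorem tr_tr_inv (g : FreeGroup (Fin n)) (z : Vert n V) : tr g (tr g⁻¹ z) = z := by
  simp [tr]

theorem tr_left_injective {g h : FreeGroup (Fin n)} {z : Vert n V} (e : tr g z = tr h z) :
    g = h := by
  simpa [tr] using e

/-- The adjacency relation determined by a graph with labelled edges on `V`. -/
def EdgeAdj (E : Letter n → V → V → Prop) (y z : Vert n V) : Prop :=
  ∃ s, z.1 = y.1 * gen s ∧ E s y.2 z.2

/-- `H` is the half space beyond the oriented edge from `a` to `b`, which is the only edge that
leaves or enters it. -/
def IsHalf (E : Letter n → V → V → Prop) (a b : Vert n V) (H : Set (Vert n V)) : Prop :=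
  a ∉ H ∧ b ∈ H ∧ ∀ y z, EdgeAdj E y z → y ∉ H → z ∈ H → y = a ∧ z = b

/-- A graph with vertex set `V` and edges labelled by letters whose `F_n`-cover over the rose is a
tree; being a tree is expressed by cuts: the cover is connected and each edge separates it. -/
structure LabelledTree (n : ℕ) (V : Type) where
  /-- There is an edge labelled `s` from `u` to `v`. -/
  E : Letter n → V → V → Prop
  symm : ∀ {s u v}, E s u v → E s.inv v u
  conn : ∀ H : Set (Vert n V), (∀ z z', EdgeAdj E z z' → z ∈ H → z' ∈ H) → H.Nonempty →
    H = Set.univ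
  bridge : ∀ z z', EdgeAdj E z z' → ∃ H, IsHalf E z z' H

theorem EdgeAdj.tr {E : Letter n → V → V → Prop} {z z' : Vert n V} (h : EdgeAdj E z z')
    (g : FreeGroup (Fin n)) : EdgeAdj E (tr g z) (tr g z') := by
  obtain ⟨s, h1, h2⟩ := h
  exact ⟨s, by simp [FreeLines.tr, h1, mul_assoc], h2⟩

theorem IsHalf.tr {E : Letter n → V → V → Prop} {z z' : Vert n V} {H : Set (Vert n V)}
    (h : IsHalf E z z' H) (g : FreeGroup (Fin n)) :
    IsHalf E (tr g z) (tr g z') {y | tr g⁻¹ y ∈ H} := by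
  refine ⟨by simpa using h.1, by simpa using h.2.1, fun y y' hy h1 h2 => ?_⟩
  obtain ⟨h3, h4⟩ := h.2.2 _ _ (hy.tr g⁻¹) h1 h2
  rw [← h3, ← h4]
  simp

theorem EdgeAdj.symm {E : Letter n → V → V → Prop} (hE : ∀ {s u v}, E s u v → E s.inv v u)
    {z z' : Vert n V} (h : EdgeAdj E z z') : EdgeAdj E z' z := by
  obtain ⟨s, h1, h2⟩ := h
  exact ⟨s.inv, by rw [h1, gen_inv, mul_inv_cancel_right], hE h2⟩

theorem IsHalf.compl {E : Letter n → V → V → Prop} (hE : ∀ {s u v}, E s u v → E s.inv v u)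
    {z z' : Vert n V} {H : Set (Vert n V)} (h : IsHalf E z z' H) : IsHalf E z' z Hᶜ := by
  refine ⟨fun h2 => h2 h.2.1, h.1, fun y y' hy h1 h2 => ?_⟩
  exact (h.2.2 y' y (hy.symm hE) h2 (not_not.mp h1)).symm

namespace LabelledTree

variable (T : LabelledTree n V)

/-- Adjacency in the tree. -/
abbrev Adj (z z' : Vert n V) : Prop := EdgeAdj T.E z z'

variable {T}

theorem Adj.symm {z z' : Vert n V} (h : T.Adj z z') : T.Adj z' z :=
  EdgeAdj.symm T.symm h

theorem eq_empty_of_closed {H : Set (Vert n V)} (h : ∀ z z', T.Adj z z' → z ∈ H → z' ∈ H)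
    {y : Vert n V} (hy : y ∉ H) : H = ∅ := by
  by_contra h0
  exact hy (T.conn H h (Set.nonempty_iff_ne_empty.mpr h0) ▸ Set.mem_univ y)

theorem isHalf_compl {z z' : Vert n V} {H : Set (Vert n V)} (h : IsHalf T.E z z' H) :
    IsHalf T.E z' z Hᶜ := h.compl T.symm

/-- The only edge across either boundary is `z z'`, and it enters both sets at once. So no edge
leaves `H ∩ H'ᶜ`, which misses `z` and is therefore empty by connectedness. -/
theorem isHalf_subset {z z' : Vert n V} {H H' : Set (Vert n V)} (h : IsHalf T.E z z' H)
    (h' : IsHalf T.E z z' H') : H ⊆ H' := by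
  have : H ∩ H'ᶜ = ∅ := by
    refine eq_empty_of_closed (T := T) (fun y y' hy hm => ?_) (y := z) (fun hm => h.1 hm.1)
    by_contra hm'
    by_cases h1 : y' ∈ H
    · have h2 : y' ∈ H' := by_contra fun h3 => hm' ⟨h1, h3⟩
      exact h.1 ((h'.2.2 _ _ hy hm.2 h2).1 ▸ hm.1)
    · exact hm.2 ((h.2.2 _ _ (Adj.symm hy) h1 hm.1).2 ▸ h'.2.1)
  intro y hy
  by_contra h1
  exact (this ▸ (⟨hy, h1⟩ : y ∈ H ∩ H'ᶜ) : y ∈ (∅ : Set _)).elim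

theorem isHalf_unique {z z' : Vert n V} {H H' : Set (Vert n V)} (h : IsHalf T.E z z' H)
    (h' : IsHalf T.E z z' H') : H = H' :=
  (isHalf_subset h h').antisymm (isHalf_subset h' h)

/-- Each of the two edges lies entirely outside the half space of the other, so neither leaves `H₁ ∩
H₂`. The intersection is closed under adjacency and misses `z₁`. -/
theorem isHalf_disjoint {z₁ z₁' z₂ z₂' : Vert n V} {H₁ H₂ : Set (Vert n V)}
    (a₁ : T.Adj z₁ z₁') (a₂ : T.Adj z₂ z₂') (h₁ : IsHalf T.E z₁ z₁' H₁)
    (h₂ : IsHalf T.E z₂ z₂' H₂) (h12 : z₁ ∉ H₂) (h21 : z₂ ∉ H₁) (hne : (z₁, z₁') ≠ (z₂, z₂')) :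
    Disjoint H₁ H₂ := by
  have k₁ : z₁' ∉ H₂ := fun h => by
    obtain ⟨e1, e2⟩ := h₂.2.2 _ _ a₁ h12 h
    exact hne (by rw [e1, e2])
  have k₂ : z₂' ∉ H₁ := fun h => by
    obtain ⟨e1, e2⟩ := h₁.2.2 _ _ a₂ h21 h
    exact hne (by rw [e1, e2])
  rw [Set.disjoint_iff_inter_eq_empty]
  refine eq_empty_of_closed (T := T) (fun y y' hy hm => ?_) (y := z₁) (fun hm => h₁.1 hm.1)
  by_contra hm'
  by_cases h1 : y' ∈ H₁
  · have h2 : y' ∉ H₂ := fun h3 => hm' ⟨h1, h3⟩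
    exact k₂ ((h₂.2.2 _ _ (Adj.symm hy) h2 hm.2).2 ▸ hm.1)
  · exact k₁ ((h₁.2.2 _ _ (Adj.symm hy) h1 hm.1).2 ▸ hm.2)

variable (T) in
open Classical in
/-- The half space beyond an oriented edge. -/
noncomputable def half (z z' : Vert n V) : Set (Vert n V) :=
  if h : T.Adj z z' then (T.bridge z z' h).choose else ∅

theorem isHalf_half {z z' : Vert n V} (h : T.Adj z z') : IsHalf T.E z z' (T.half z z') := by
  rw [half, dif_pos h]
  exact (T.bridge z z' h).choose_spec

theorem half_symm {z z' : Vert n V} (h : T.Adj z z') : T.half z' z = (T.half z z')ᶜ :=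
  isHalf_unique (isHalf_half (Adj.symm h)) (isHalf_compl (isHalf_half h))

theorem half_tr {z z' : Vert n V} (h : T.Adj z z') (g : FreeGroup (Fin n)) :
    T.half (tr g z) (tr g z') = {y | tr g⁻¹ y ∈ T.half z z'} :=
  isHalf_unique (isHalf_half (h.tr g)) ((isHalf_half h).tr g)

/-- Every finite set of vertices lies in a finite connected one. -/
theorem exists_finite_connected (T : LabelledTree n V) (z₀ : Vert n V) (S : Set (Vert n V))
    (hS : S.Finite) :
    ∃ A : Set (Vert n V), A.Finite ∧ z₀ ∈ A ∧ S ⊆ A ∧ ∀ H : Set (Vert n V), z₀ ∉ H →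
      (∃ a ∈ A, a ∈ H) → ∃ a ∈ A, ∃ b ∈ A, T.Adj a b ∧ a ∉ H ∧ b ∈ H := by
  have key : {z : Vert n V | ∃ A : Set (Vert n V), A.Finite ∧ z₀ ∈ A ∧ z ∈ A ∧
      ∀ H : Set (Vert n V), z₀ ∉ H → (∃ a ∈ A, a ∈ H) →
        ∃ a ∈ A, ∃ b ∈ A, T.Adj a b ∧ a ∉ H ∧ b ∈ H} = Set.univ := by
    refine T.conn _ ?_ ⟨z₀, {z₀}, Set.finite_singleton _, rfl, rfl, ?_⟩
    · rintro z z' hz ⟨A, h1, h2, h3, h4⟩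
      refine ⟨insert z' A, h1.insert _, Or.inr h2, Or.inl rfl, ?_⟩
      rintro H h5 ⟨a, ha, haH⟩
      by_cases h6 : ∃ a ∈ A, a ∈ H
      · obtain ⟨a, ha, b, hb, h7⟩ := h4 H h5 h6
        exact ⟨a, Or.inr ha, b, Or.inr hb, h7⟩
      · rcases ha with rfl | ha
        · exact ⟨z, Or.inr h3, a, Or.inl rfl, hz, fun h => h6 ⟨z, h3, h⟩, haH⟩
        · exact (h6 ⟨a, ha, haH⟩).elim
    · rintro H h1 ⟨a, rfl, ha⟩
      exact (h1 ha).elim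
  have key2 : ∀ z : Vert n V, ∃ A : Set (Vert n V), A.Finite ∧ z₀ ∈ A ∧ z ∈ A ∧
      ∀ H : Set (Vert n V), z₀ ∉ H → (∃ a ∈ A, a ∈ H) →
        ∃ a ∈ A, ∃ b ∈ A, T.Adj a b ∧ a ∉ H ∧ b ∈ H := fun z => by
    have : z ∈ (Set.univ : Set (Vert n V)) := Set.mem_univ z
    rwa [← key] at this
  choose A h1 h2 h3 h4 using key2
  refine ⟨⋃ z ∈ insert z₀ S, A z, (hS.insert _).biUnion fun z _ => h1 z, ?_, ?_, ?_⟩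
  · exact Set.mem_biUnion (Set.mem_insert _ _) (h2 z₀)
  · exact fun z hz => Set.mem_biUnion (Set.mem_insert_of_mem _ hz) (h3 z)
  · rintro H h5 ⟨a, ha, haH⟩
    obtain ⟨z, hz, haz⟩ := Set.mem_iUnion₂.mp ha
    obtain ⟨a', ha', b', hb', h6⟩ := h4 z H h5 ⟨a, haz, haH⟩
    exact ⟨a', Set.mem_biUnion hz ha', b', Set.mem_biUnion hz hb', h6⟩

end LabelledTree

/-! ### Almost invariant sets and their ends -/

/-- `H` separates only finitely many translates of each pair of vertices. -/
def AlmostInvariant (H : Set (Vert n V)) : Prop :=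
  ∀ y y', {g | ¬ (tr g y ∈ H ↔ tr g y' ∈ H)}.Finite

theorem AlmostInvariant.compl {H : Set (Vert n V)} (h : AlmostInvariant H) :
    AlmostInvariant Hᶜ := fun y y' => by
  simpa only [Set.mem_compl_iff, not_iff_not] using h y y'

/-- Translates of an adjacent pair are separated by `H` only when they equal the edge `z z'` in one
of its orientations, so for at most two `g`. Connectedness extends finiteness to all pairs. -/
theorem LabelledTree.almostInvariant {T : LabelledTree n V} {z z' : Vert n V}
    {H : Set (Vert n V)} (h : IsHalf T.E z z' H) : AlmostInvariant H := by
  intro y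
  have : {y' | {g | ¬ (tr g y ∈ H ↔ tr g y' ∈ H)}.Finite} = Set.univ := by
    refine T.conn _ (fun x x' hx hxm => ?_) ⟨y, by simp⟩
    have h2 : {g | ¬ (tr g x ∈ H ↔ tr g x' ∈ H)} ⊆
        {z.1 * x.1⁻¹, z'.1 * x.1⁻¹} := by
      intro g hg
      simp only [Set.mem_ofPred_eq] at hg
      by_cases h3 : tr g x ∈ H
      · have h4 : tr g x' ∉ H := fun h5 => hg ⟨fun _ => h5, fun _ => h3⟩
        have := (h.2.2 _ _ (LabelledTree.Adj.symm (hx.tr g)) h4 h3).2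
        right
        simp [← this, tr]
      · have h4 : tr g x' ∈ H := by_contra fun h5 => hg ⟨fun h6 => (h3 h6).elim, fun h6 => (h5 h6).elim⟩
        have := (h.2.2 _ _ (hx.tr g) h3 h4).1
        left
        simp [← this, tr]
    refine (hxm.union ((Set.toFinite _).subset h2)).subset fun g hg => ?_
    simp only [Set.mem_ofPred_eq, Set.mem_union] at hg ⊢
    tauto
  intro y'
  have h2 : y' ∈ (Set.univ : Set (Vert n V)) := Set.mem_univ y'
  rwa [← this] at h2

/-- `H` is locally constant outside the ball of radius `N`. -/
def StableFrom (H : Set (Vert n V)) (N : ℕ) : Prop :=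
  ∀ g : FreeGroup (Fin n), N ≤ g.norm → ∀ u u',
    ((g, u) ∈ H ↔ (g, u') ∈ H) ∧ ∀ s, ((g, u) ∈ H ↔ (g * gen s, u') ∈ H)

/-- Up to translation there are finitely many pairs in one fibre or in adjacent fibres, so all
exceptional `g` lie in a common ball. -/
theorem AlmostInvariant.exists_stableFrom [Finite V] {H : Set (Vert n V)}
    (h : AlmostInvariant H) : ∃ N, StableFrom H N := by
  have hf : (⋃ q : V × V × Option (Letter n), {g | ¬ (tr g ((1 : FreeGroup (Fin n)), q.1) ∈ H ↔
      tr g ((q.2.2.elim 1 gen : FreeGroup (Fin n)), q.2.1) ∈ H)}).Finite :=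
    Set.finite_iUnion fun q => h _ _
  obtain ⟨N, hN⟩ := (hf.image FreeGroup.norm).bddAbove
  have key : ∀ g : FreeGroup (Fin n), N + 1 ≤ g.norm → ∀ (u u' : V) (o : Option (Letter n)),
      (g, u) ∈ H ↔ (g * o.elim 1 gen, u') ∈ H := by
    intro g hg u u' o
    by_contra h1
    have h2 : g.norm ≤ N := hN ⟨g, Set.mem_iUnion.mpr ⟨(u, u', o), by simpa [tr] using h1⟩, rfl⟩
    omega
  refine ⟨N + 1, fun g hg u u' => ⟨by simpa using key g hg u u' none, fun s => ?_⟩⟩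
  simpa using key g hg u u' (some s)

/-- The ray `ξ` eventually stays in `H`. -/
def EndsIn (H : Set (Vert n V)) (ξ : Boundary n) : Prop :=
  ∀ᶠ i in atTop, ∀ u, (pre ξ i, u) ∈ H

theorem StableFrom.pre_iff {H : Set (Vert n V)} {N : ℕ} (h : StableFrom H N) (ξ : Boundary n)
    (u u' : V) (i : ℕ) : (pre ξ (N + i), u) ∈ H ↔ (pre ξ N, u') ∈ H := by
  induction i generalizing u with
  | zero => exact (h _ (by rw [norm_pre]; omega) u u').1
  | succ i ih =>
    rw [← ih u, ← add_assoc, pre_succ]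
    exact ((h _ (by rw [norm_pre]; omega) u u).2 _).symm

/-- Membership of an end is read off at one vertex. The free depth `i` allows two sets with
different radii to be compared at the same vertex. -/
theorem StableFrom.endsIn_iff {H : Set (Vert n V)} {N : ℕ} (h : StableFrom H N)
    (ξ : Boundary n) (u : V) (i : ℕ) : EndsIn H ξ ↔ (pre ξ (N + i), u) ∈ H := by
  constructor
  · intro h1
    obtain ⟨j, hj⟩ := eventually_atTop.mp h1
    have := hj (N + j) (by omega) u
    rw [h.pre_iff ξ u u] at this ⊢
    exact this
  · intro h1
    refine eventually_atTop.mpr ⟨N, fun j hj u' => ?_⟩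
    obtain ⟨k, rfl⟩ := Nat.exists_eq_add_of_le hj
    rw [h.pre_iff ξ u' u]
    rwa [h.pre_iff ξ u u] at h1

theorem AlmostInvariant.endsIn_compl [Finite V] [Nonempty V] {H : Set (Vert n V)}
    (h : AlmostInvariant H) (ξ : Boundary n) : EndsIn Hᶜ ξ ↔ ¬ EndsIn H ξ := by
  obtain ⟨N, hN⟩ := h.exists_stableFrom
  obtain ⟨N', hN'⟩ := h.compl.exists_stableFrom
  obtain ⟨u⟩ := ‹Nonempty V›
  rw [hN.endsIn_iff ξ u N', hN'.endsIn_iff ξ u N, add_comm N']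
  rfl

theorem AlmostInvariant.endsIn_of_forall [Finite V] {H : Set (Vert n V)}
    (h : AlmostInvariant H) {ξ : Boundary n} {u : ℕ → V} {k : ℕ}
    (hu : ∀ i, k ≤ i → (pre ξ i, u i) ∈ H) : EndsIn H ξ := by
  obtain ⟨N, hN⟩ := h.exists_stableFrom
  exact (hN.endsIn_iff ξ (u (N + k)) k).mpr (hu _ (by omega))

theorem AlmostInvariant.endsIn_congr [Finite V] [Nonempty V] {H : Set (Vert n V)}
    (h : AlmostInvariant H) : ∃ N, ∀ ξ ξ' : Boundary n, (∀ i < N, ξ'.1 i = ξ.1 i) →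
      (EndsIn H ξ' ↔ EndsIn H ξ) := by
  obtain ⟨N, hN⟩ := h.exists_stableFrom
  obtain ⟨u⟩ := ‹Nonempty V›
  refine ⟨N, fun ξ ξ' hξ => ?_⟩
  rw [hN.endsIn_iff ξ u 0, hN.endsIn_iff ξ' u 0, add_zero, pre_congr hξ]

theorem EndsIn.mono {H H' : Set (Vert n V)} (h : H ⊆ H') {ξ : Boundary n} (hξ : EndsIn H ξ) :
    EndsIn H' ξ :=
  Eventually.mono hξ fun _ h1 u => h (h1 u)

theorem EndsIn.smul {H : Set (Vert n V)} {ξ : Boundary n} (h : EndsIn H ξ)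
    (g : FreeGroup (Fin n)) : EndsIn {y | tr g⁻¹ y ∈ H} (g • ξ) := by
  obtain ⟨j, k, hjk⟩ := exists_pre_smul g ξ
  obtain ⟨m, hm⟩ := eventually_atTop.mp h
  refine eventually_atTop.mpr ⟨j + m, fun i hi u => ?_⟩
  obtain ⟨l, rfl⟩ := Nat.exists_eq_add_of_le hi
  have := hm (k + (m + l)) (by omega) u
  simpa [tr, add_assoc, hjk] using this

end FreeLines

namespace FreeLines

open Filter

variable {n : ℕ} {V : Type}

/-! ### Lifts of lines and their paths in trees -/

/-- The lifts of the lines in `B`. -/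
def lifts (B : Set (Line n)) : Set (Boundary n × Boundary n) :=
  {p | ∃ h : p.1 ≠ p.2, Line.mk ⟨p, h⟩ ∈ B}

theorem line_mk_smul (g : FreeGroup (Fin n)) (p : Boundary n × Boundary n) (h : p.1 ≠ p.2)
    (h' : (g • p).1 ≠ (g • p).2) : Line.mk ⟨g • p, h'⟩ = Line.mk ⟨p, h⟩ :=
  Quotient.sound (s := lineSetoid n) ⟨g⁻¹, Or.inl (inv_smul_smul g p)⟩

theorem line_mk_swap (p : Boundary n × Boundary n) (h : p.1 ≠ p.2) (h' : p.swap.1 ≠ p.swap.2) :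
    Line.mk ⟨p.swap, h'⟩ = Line.mk ⟨p, h⟩ :=
  Quotient.sound (s := lineSetoid n) ⟨1, Or.inr (one_smul _ _)⟩

theorem smul_mem_lifts {B : Set (Line n)} {p : Boundary n × Boundary n} (hp : p ∈ lifts B)
    (g : FreeGroup (Fin n)) : g • p ∈ lifts B := by
  obtain ⟨h, hB⟩ := hp
  refine ⟨fun h1 => h (smul_left_cancel g h1), ?_⟩
  rwa [line_mk_smul g p h]

theorem swap_mem_lifts {B : Set (Line n)} {p : Boundary n × Boundary n} (hp : p ∈ lifts B) :
    p.swap ∈ lifts B := by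
  obtain ⟨h, hB⟩ := hp
  refine ⟨h.symm, ?_⟩
  rwa [line_mk_swap p h]

theorem lifts_mono {B B' : Set (Line n)} (h : B ⊆ B') : lifts B ⊆ lifts B' :=
  fun _ ⟨h1, h2⟩ => ⟨h1, h h2⟩

/-- The line with endpoints `p` passes through the base vertex. -/
def Pointed (p : Boundary n × Boundary n) : Prop := p.1.1 0 ≠ p.2.1 0

theorem Pointed.swap {p : Boundary n × Boundary n} (h : Pointed p) : Pointed p.swap := Ne.symm h

/-- Translate the line so that the next vertex becomes the base vertex. -/
def step (p : Boundary n × Boundary n) : Boundary n × Boundary n := (gen (p.1.1 0))⁻¹ • p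

theorem step_mem_lifts {B : Set (Line n)} {p : Boundary n × Boundary n} (hp : p ∈ lifts B) :
    step p ∈ lifts B := smul_mem_lifts hp _

theorem step_fst_apply (p : Boundary n × Boundary n) (i : ℕ) :
    (step p).1.1 i = p.1.1 (i + 1) := gen_inv_smul_apply p.1 i

theorem Pointed.step_snd_apply_zero {p : Boundary n × Boundary n} (h : Pointed p) :
    (step p).2.1 0 = (p.1.1 0).inv := gen_inv_smul_apply_zero_of_ne (Ne.symm h)

theorem Pointed.step {p : Boundary n × Boundary n} (h : Pointed p) : Pointed (step p) := by
  rw [Pointed, h.step_snd_apply_zero, step_fst_apply]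
  exact p.1.2 0

theorem Pointed.step_swap_step {p : Boundary n × Boundary n} (h : Pointed p) :
    FreeLines.step (FreeLines.step p).swap = p.swap := by
  have h1 : (FreeLines.step p).swap.1.1 0 = (p.1.1 0).inv := h.step_snd_apply_zero
  rw [FreeLines.step, h1, gen_inv, inv_inv]
  exact congrArg Prod.swap (smul_inv_smul (gen (p.1.1 0)) p)

/-- Translate the line by `i` steps. -/
def shift (p : Boundary n × Boundary n) (i : ℕ) : Boundary n × Boundary n := (pre p.1 i)⁻¹ • p

theorem shift_mem_lifts {B : Set (Line n)} {p : Boundary n × Boundary n} (hp : p ∈ lifts B)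
    (i : ℕ) : shift p i ∈ lifts B := smul_mem_lifts hp _

theorem shift_zero (p : Boundary n × Boundary n) : shift p 0 = p := by simp [shift]

theorem shift_fst_apply (p : Boundary n × Boundary n) (i j : ℕ) :
    (shift p i).1.1 j = p.1.1 (i + j) := pre_inv_smul_apply p.1 i j

theorem shift_succ (p : Boundary n × Boundary n) (i : ℕ) : shift p (i + 1) = step (shift p i) := by
  rw [step, shift_fst_apply, shift, shift, pre_succ, mul_inv_rev, mul_smul, add_zero]

theorem Pointed.shift {p : Boundary n × Boundary n} (h : Pointed p) (i : ℕ) :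
    Pointed (shift p i) := by
  induction i with
  | zero => rwa [shift_zero]
  | succ i ih => rw [shift_succ]; exact ih.step

/-- Every line has a translate through the base vertex. -/
theorem exists_pointed_smul {p : Boundary n × Boundary n} (h : p.1 ≠ p.2) :
    ∃ g : FreeGroup (Fin n), Pointed (g • p) := by
  have h1 : ∃ i, p.1.1 i ≠ p.2.1 i := by
    by_contra! h2
    exact h (Subtype.ext (funext h2))
  classical
  have h2 := Nat.find_spec h1
  have h3 : pre p.1 (Nat.find h1) = pre p.2 (Nat.find h1) :=
    pre_congr fun i hi => not_not.mp (Nat.find_min h1 hi)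
  refine ⟨(pre p.1 (Nat.find h1))⁻¹, ?_⟩
  have h4 := pre_inv_smul_apply p.1 (Nat.find h1) 0
  have h5 := pre_inv_smul_apply p.2 (Nat.find h1) 0
  rw [← h3] at h5
  change ((pre p.1 (Nat.find h1))⁻¹ • p.1).1 0 ≠ ((pre p.1 (Nat.find h1))⁻¹ • p.2).1 0
  rwa [h4, h5]

/-- A choice of a lift to the tree `T` of each line of `B`: `lam p` is the vertex of the lift
over the base vertex. -/
structure LineMap (T : LabelledTree n V) (B : Set (Line n)) where
  /-- The vertex, in the fibre of the base vertex, on the lift of a pointed line. -/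
  lam : Boundary n × Boundary n → V
  lam_swap : ∀ p ∈ lifts B, Pointed p → lam p.swap = lam p
  edge : ∀ p ∈ lifts B, Pointed p → T.E (p.1.1 0) (lam p) (lam (step p))

/-- The neighbour of `(1, u)` in direction `d`. -/
def nbr (d : Letter n × V) : Vert n V := (gen d.1, d.2)

theorem adj_nbr {T : LabelledTree n V} {u : V} {d : Letter n × V} (h : T.E d.1 u d.2) :
    T.Adj (1, u) (nbr d) := ⟨d.1, by simp [nbr], h⟩

namespace LineMap

variable {T : LabelledTree n V} {B : Set (Line n)} (φ : LineMap T B)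

/-- The direction in which the lift of `p` leaves the base fibre. -/
def dir (p : Boundary n × Boundary n) : Letter n × V := (p.1.1 0, φ.lam (step p))

theorem edge_dir {p : Boundary n × Boundary n} (hp : p ∈ lifts B) (h : Pointed p) :
    T.E (φ.dir p).1 (φ.lam p) (φ.dir p).2 := φ.edge p hp h

theorem edge_dir_swap {p : Boundary n × Boundary n} (hp : p ∈ lifts B) (h : Pointed p) :
    T.E (φ.dir p.swap).1 (φ.lam p) (φ.dir p.swap).2 := by
  rw [← φ.lam_swap p hp h]
  exact φ.edge p.swap (swap_mem_lifts hp) h.swap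

theorem dir_swap_ne {p : Boundary n × Boundary n} (h : Pointed p) :
    φ.dir p ≠ φ.dir p.swap := fun h1 => h (congrArg Prod.fst h1)

theorem dir_swap_step {p : Boundary n × Boundary n} (hp : p ∈ lifts B) (h : Pointed p) :
    φ.dir (step p).swap = ((p.1.1 0).inv, φ.lam p) := by
  refine Prod.ext h.step_snd_apply_zero ?_
  change φ.lam (step (step p).swap) = _
  rw [h.step_swap_step, φ.lam_swap p hp h]

/-- Some line of `B'` crosses the edge labelled `s` from `u` to `w`. -/
def Crosses (B' : Set (Line n)) (s : Letter n) (u w : V) : Prop :=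
  ∃ p ∈ lifts B', Pointed p ∧ φ.lam p = u ∧ φ.dir p = (s, w)

theorem Crosses.symm {φ : LineMap T B} {B' : Set (Line n)} (hB : B' ⊆ B) {s : Letter n} {u w : V}
    (h : φ.Crosses B' s u w) : φ.Crosses B' s.inv w u := by
  obtain ⟨p, h1, h2, h3, h4⟩ := h
  have h5 := step_mem_lifts h1
  refine ⟨(step p).swap, swap_mem_lifts h5, h2.step.swap, ?_, ?_⟩
  · rw [φ.lam_swap _ (lifts_mono hB h5) h2.step]
    exact congrArg Prod.snd h4
  · rw [φ.dir_swap_step (lifts_mono hB h1) h2, h3]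
    exact congrArg (fun d => (Letter.inv d.1, u)) h4

/-- The vertices of the lift of a line. -/
def vert (p : Boundary n × Boundary n) (i : ℕ) : Vert n V := (pre p.1 i, φ.lam (shift p i))

theorem vert_zero (p : Boundary n × Boundary n) : φ.vert p 0 = (1, φ.lam p) := by
  simp [vert, shift_zero]

theorem vert_one (p : Boundary n × Boundary n) :
    φ.vert p 1 = (gen (φ.dir p).1, (φ.dir p).2) := by
  have h : shift p 1 = step p := by simpa [shift_zero] using shift_succ p 0
  rw [vert, pre_one, h]
  rfl

theorem vert_adj {p : Boundary n × Boundary n} (hp : p ∈ lifts B) (h : Pointed p) (i : ℕ) :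
    T.Adj (φ.vert p i) (φ.vert p (i + 1)) := by
  have h1 := φ.edge _ (shift_mem_lifts hp i) (h.shift i)
  refine ⟨p.1.1 i, pre_succ _ _, ?_⟩
  rw [shift_fst_apply, add_zero] at h1
  simp only [vert, shift_succ]
  exact h1

theorem vert_injective (p : Boundary n × Boundary n) : Function.Injective (φ.vert p) :=
  fun _ _ h => pre_injective p.1 (congrArg Prod.fst h)

/-- The vertices of the lift are distinct, so after leaving the base fibre along its first edge the
lift never returns through that edge. -/
theorem endsIn_half [Finite V] {p : Boundary n × Boundary n} (hp : p ∈ lifts B) (h : Pointed p) :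
    EndsIn (T.half (1, φ.lam p) (nbr (φ.dir p))) p.1 := by
  have hH := LabelledTree.isHalf_half (adj_nbr (φ.edge_dir hp h))
  refine (LabelledTree.almostInvariant hH).endsIn_of_forall (u := fun i => φ.lam (shift p i))
    (k := 1) fun i hi => ?_
  change φ.vert p i ∈ _
  induction i, hi using Nat.le_induction with
  | base => rw [vert_one]; exact hH.2.1
  | succ i hi ih =>
    by_contra h1
    have h2 := (hH.2.2 _ _ (LabelledTree.Adj.symm (φ.vert_adj hp h i)) h1 ih).1
    rw [← φ.vert_zero] at h2
    have := φ.vert_injective p h2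
    omega

theorem endsIn_half_swap [Finite V] {p : Boundary n × Boundary n} (hp : p ∈ lifts B)
    (h : Pointed p) : EndsIn (T.half (1, φ.lam p) (nbr (φ.dir p.swap))) p.2 := by
  have := φ.endsIn_half (swap_mem_lifts hp) h.swap
  rwa [φ.lam_swap p hp h] at this

end LineMap

end FreeLines

namespace FreeLines

open Filter
open scoped Pointwise

/-! ### Free factorizations -/

section Factorization

variable {G : Type*} [Group G]

theorem conjClass_eq_iff {A A' : Subgroup G} :
    conjClass A' = conjClass A ↔ ∃ g : ConjAct G, g • A = A' := by
  exact Quotient.eq (r := MulAction.orbitRel (ConjAct G) (Subgroup G)).trans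
    MulAction.orbitRel_apply

theorem conjClass_eq_top {A : Subgroup G} (h : conjClass ⊤ = conjClass A) : A = ⊤ := by
  obtain ⟨g, hg⟩ := conjClass_eq_iff.mp h
  rw [eq_top_iff]
  intro x _
  have : g • x ∈ g • A := hg ▸ Subgroup.mem_top _
  rwa [Subgroup.smul_mem_pointwise_smul_iff] at this

/-- A free factor is a retract of `G`: kill the other factors. -/
theorem IsFreeFactorization.fg [Group.FG G] {ι : Type*} {A : ι → Subgroup G}
    (h : IsFreeFactorization ⊤ A) (i : ι) : (A i).FG := by
  classical
  have hb : Function.Bijective (Monoid.CoprodI.lift fun i => (A i).subtype) :=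
    ⟨h.1, MonoidHom.range_eq_top.mp h.2⟩
  let e := MulEquiv.ofBijective _ hb
  rw [← Group.fg_iff_subgroup_fg]
  have hs : Function.Surjective
      ((Monoid.CoprodI.lift (Pi.mulSingle i (MonoidHom.id (A i)))).comp e.symm.toMonoidHom) :=
    (Monoid.CoprodI.of_leftInverse (M := fun i => A i) i).surjective.comp e.symm.surjective
  exact Group.fg_of_surjective hs

theorem ne_bot_and_fg_of_conjClass_eq {A A' : Subgroup G} (h : conjClass A' = conjClass A)
    (h1 : A ≠ ⊥) (h2 : A.FG) : A' ≠ ⊥ ∧ A'.FG := by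
  obtain ⟨g, rfl⟩ := conjClass_eq_iff.mp h
  constructor
  · intro h3
    apply h1
    rw [← inv_smul_smul g A, h3, Subgroup.smul_bot]
  · rw [Subgroup.fg_iff_submonoid_fg] at h2 ⊢
    exact h2.map _

/-- Supplies the trivial complement `B` that `IsFreeFactorSystem` asks for when the `A i` already
generate. -/
theorem IsFreeFactorization.snoc_bot {H : Subgroup G} {k : ℕ} {A : Fin k → Subgroup G}
    (h : IsFreeFactorization H A) :
    IsFreeFactorization H (Fin.snoc (α := fun _ => Subgroup G) A ⊥) := by
  set A' : Fin (k + 1) → Subgroup G := Fin.snoc (α := fun _ => Subgroup G) A ⊥ with hA'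
  have hA : ∀ i : Fin k, A' i.castSucc = A i := fun i => by rw [hA', Fin.snoc_castSucc]
  have hlast : A' (Fin.last k) = ⊥ := by rw [hA', Fin.snoc_last]
  let χ : Monoid.CoprodI (fun i => A i) →* Monoid.CoprodI (fun i => A' i) :=
    Monoid.CoprodI.lift fun i =>
      (Monoid.CoprodI.of (M := fun i => A' i) (i := i.castSucc)).comp
        (Subgroup.inclusion (hA i).ge)
  have hcomp : (Monoid.CoprodI.lift fun i => (A' i).subtype).comp χ =
      Monoid.CoprodI.lift fun i => (A i).subtype := by
    refine Monoid.CoprodI.ext_hom _ _ fun i => ?_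
    ext x
    simp [χ]
  have hsurj : Function.Surjective χ := by
    intro m
    induction m using Monoid.CoprodI.induction_on with
    | one => exact ⟨1, map_one _⟩
    | of i x =>
      induction i using Fin.lastCases with
      | last =>
        refine ⟨1, ?_⟩
        have hx : x = 1 := Subtype.ext (Subgroup.mem_bot.mp (hlast ▸ x.2))
        rw [hx, map_one, map_one]
      | cast i =>
        refine ⟨Monoid.CoprodI.of (M := fun i => A i) (⟨x.1, hA i ▸ x.2⟩ : A i), ?_⟩
        simp only [χ, Monoid.CoprodI.lift_of]
        rfl
    | mul a b ha hb =>
      obtain ⟨a', rfl⟩ := ha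
      obtain ⟨b', rfl⟩ := hb
      exact ⟨a' * b', map_mul _ _ _⟩
  constructor
  · intro a b hab
    obtain ⟨a', rfl⟩ := hsurj a
    obtain ⟨b', rfl⟩ := hsurj b
    rw [← MonoidHom.comp_apply, ← MonoidHom.comp_apply, hcomp] at hab
    rw [h.1 hab]
  · rw [← h.2, ← hcomp, MonoidHom.range_comp, MonoidHom.range_eq_top.mpr hsurj,
      MonoidHom.range_eq_map]

theorem eq_top_of_isFreeFactor_top {A : Subgroup G} (h : IsFreeFactor ⊤ A) : A = ⊤ := by
  obtain ⟨C, -, hC⟩ := h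
  rw [eq_top_iff, ← hC]
  intro x hx
  exact ⟨Monoid.CoprodI.of (M := fun i => (![⊤, C] : Fin 2 → Subgroup G) i) (i := 0) ⟨x, hx⟩,
    Monoid.CoprodI.lift_of _ _⟩

theorem infinite_of_ne_bot [IsMulTorsionFree G] {A : Subgroup G} (h : A ≠ ⊥) :
    (A : Set G).Infinite := by
  obtain ⟨a, ha, h1⟩ := A.bot_or_exists_ne_one.resolve_left h
  exact (infinite_zpowers.mpr (not_isOfFinOrder_of_isMulTorsionFree h1)).mono
    (Subgroup.zpowers_le.mpr ha)

open Cardinal in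
/-- The ping-pong lemma for two subgroups of a torsion free group. -/
theorem isFreeFactorization_of_ping_pong [IsMulTorsionFree G] {α : Type*} [MulAction G α]
    {A C : Subgroup G} {X Y : Set α} (hX : X.Nonempty) (hY : Y.Nonempty) (hXY : Disjoint X Y)
    (hA : ∀ a ∈ A, a ≠ 1 → ∀ y ∈ Y, a • y ∈ X) (hC : ∀ c ∈ C, c ≠ 1 → ∀ x ∈ X, c • x ∈ Y)
    (hC1 : C ≠ ⊥) (htop : A ⊔ C = ⊤) : IsFreeFactorization ⊤ ![A, C] := by
  constructor
  · refine Monoid.CoprodI.lift_injective_of_ping_pong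
      (H := fun i => (![A, C] : Fin 2 → Subgroup G) i) _ (Or.inr ⟨1, ?_⟩) ![X, Y] ?_ ?_ ?_
    · have : Infinite C := (infinite_of_ne_bot hC1).to_subtype
      exact ofNat_le_aleph0.trans (aleph0_le_mk C)
    · intro i
      fin_cases i
      · exact hX
      · exact hY
    · intro i j hij
      fin_cases i <;> fin_cases j
      · exact (hij rfl).elim
      · exact hXY
      · exact hXY.symm
      · exact (hij rfl).elim
    · intro i j hij h h1
      rintro _ ⟨y, hy, rfl⟩
      fin_cases i <;> fin_cases j
      · exact (hij rfl).elim
      · exact hA _ h.2 (fun h2 => h1 (Subtype.ext h2)) y hy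
      · exact hC _ h.2 (fun h2 => h1 (Subtype.ext h2)) y hy
      · exact (hij rfl).elim
  · rw [Monoid.CoprodI.range_eq_iSup, eq_top_iff, ← htop]
    refine sup_le ?_ ?_
    · refine le_trans ?_ (le_iSup _ (0 : Fin 2))
      exact A.range_subtype.ge
    · refine le_trans ?_ (le_iSup _ (1 : Fin 2))
      exact C.range_subtype.ge

end Factorization

/-! ### The splitting given by an orbit of edges -/

section Splitting

variable {n : ℕ} {V : Type} {T : LabelledTree n V} {z z' : Vert n V} {H : Set (Vert n V)}

/-- No translate of `H` separates `y` from `y'`. -/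
def Unsep (H : Set (Vert n V)) (y y' : Vert n V) : Prop := ∀ g, tr g y ∈ H ↔ tr g y' ∈ H

theorem Unsep.refl (H : Set (Vert n V)) (y : Vert n V) : Unsep H y y := fun _ => Iff.rfl

theorem Unsep.symm {y y' : Vert n V} (h : Unsep H y y') : Unsep H y' y := fun g => (h g).symm

theorem Unsep.trans {y y' y'' : Vert n V} (h : Unsep H y y') (h' : Unsep H y' y'') :
    Unsep H y y'' := fun g => (h g).trans (h' g)

theorem Unsep.tr {y y' : Vert n V} (h : Unsep H y y') (a : FreeGroup (Fin n)) :
    Unsep H (tr a y) (tr a y') := fun g => by simpa only [tr_tr] using h (g * a)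

theorem Unsep.mem_iff {y y' : Vert n V} (h : Unsep H y y') : y ∈ H ↔ y' ∈ H := by
  simpa using h 1

theorem Unsep.inv_tr {y y' : Vert n V} {a : FreeGroup (Fin n)} (h : Unsep H (FreeLines.tr a y) y') :
    Unsep H y (FreeLines.tr a⁻¹ y') := by
  simpa using h.tr a⁻¹

theorem unsep_compl {y y' : Vert n V} : Unsep Hᶜ y y' ↔ Unsep H y y' := by
  simp only [Unsep, Set.mem_compl_iff, not_iff_not]

/-- The classes of `Unsep H` are the pieces of the tree cut along the orbit of the edge `z z'`; they
are the vertices of the Bass-Serre tree of the splitting. -/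
theorem unsep_or_of_adj (hH : IsHalf T.E z z' H) {y y' : Vert n V} (h : T.Adj y y') :
    Unsep H y y' ∨ (∃ g, y = tr g z ∧ y' = tr g z') ∨ ∃ g, y = tr g z' ∧ y' = tr g z := by
  by_contra! hc
  obtain ⟨h1, h2, h3⟩ := hc
  apply h1
  intro g
  by_contra h4
  by_cases h5 : tr g y ∈ H
  · have h6 : tr g y' ∉ H := fun h6 => h4 ⟨fun _ => h6, fun _ => h5⟩
    obtain ⟨e1, e2⟩ := hH.2.2 _ _ (LabelledTree.Adj.symm (h.tr g)) h6 h5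
    exact h3 g⁻¹ (by simp [← e2]) (by simp [← e1])
  · have h6 : tr g y' ∈ H := by
      by_contra h6
      exact h4 ⟨fun h => (h5 h).elim, fun h => (h6 h).elim⟩
    obtain ⟨e1, e2⟩ := hH.2.2 _ _ (h.tr g) h5 h6
    exact h2 g⁻¹ (by simp [← e1]) (by simp [← e2])

/-- The stabilizer of the class of `y`. -/
def classStab (H : Set (Vert n V)) (y : Vert n V) : Subgroup (FreeGroup (Fin n)) where
  carrier := {g | Unsep H (tr g y) y}
  one_mem' := by simpa using Unsep.refl H y
  mul_mem' {a b} ha hb := by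
    have := (Unsep.tr hb a).trans ha
    rwa [tr_tr] at this
  inv_mem' {a} ha := (Unsep.inv_tr ha).symm

theorem mem_classStab {y : Vert n V} {g : FreeGroup (Fin n)} :
    g ∈ classStab H y ↔ Unsep H (tr g y) y := Iff.rfl

theorem mul_mem_classStab {y : Vert n V} {g h : FreeGroup (Fin n)}
    (hu : Unsep H (tr g y) (tr h y)) : h⁻¹ * g ∈ classStab H y := by
  have := hu.tr h⁻¹
  rwa [tr_inv_tr, tr_tr] at this

theorem classStab_compl (y : Vert n V) : classStab Hᶜ y = classStab H y := by
  ext g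
  exact unsep_compl

/-- The edge `z z'` and its translate by `a` are distinct and start in the same class, so the half
spaces beyond them are disjoint. -/
theorem tr_notMem_of_mem_classStab (hadj : T.Adj z z') (hH : IsHalf T.E z z' H)
    {a : FreeGroup (Fin n)} (ha : a ∈ classStab H z) (h1 : a ≠ 1) {y : Vert n V} (hy : y ∈ H) :
    tr a y ∉ H := by
  have hd := LabelledTree.isHalf_disjoint hadj (hadj.tr a) hH (hH.tr a)
    (fun h => hH.1 ((Unsep.mem_iff ((classStab H z).inv_mem ha)).mp h))
    (fun h => hH.1 ((Unsep.mem_iff ha).mp h))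
    (fun h => h1 (tr_left_injective (z := z) (by simpa using (congrArg Prod.fst h).symm)))
  intro h2
  exact Set.disjoint_left.mp hd h2 (by simpa using hy)

theorem not_unsep (hH : IsHalf T.E z z' H) : ¬ Unsep H z z' := fun h =>
  hH.1 (h.mem_iff.mpr hH.2.1)

/-- Every vertex is in the class of a translate of one of the endpoints of the edge. -/
theorem eq_top_of_classStab_le (hH : IsHalf T.E z z' H) {K : Subgroup (FreeGroup (Fin n))}
    (h1 : classStab H z ≤ K) (h2 : classStab H z' ≤ K)
    (h3 : ∀ g, Unsep H (tr g z) z' → g ∈ K) :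
    K = ⊤ ∧ ∀ y, ∃ h, Unsep H y (tr h z) ∨ Unsep H y (tr h z') := by
  have h4 : ∀ g h, h ∈ K → Unsep H (tr g z) (tr h z') → g ∈ K := fun g h hh hu => by
    have := h3 (h⁻¹ * g) (by simpa [tr_tr] using hu.tr h⁻¹)
    simpa using K.mul_mem hh this
  have key : {y | ∃ h ∈ K, Unsep H y (tr h z) ∨ Unsep H y (tr h z')} = Set.univ := by
    refine T.conn _ ?_ ⟨z, 1, K.one_mem, Or.inl (by simpa using Unsep.refl H z)⟩
    rintro y y' hy ⟨h, hh, hu⟩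
    rcases unsep_or_of_adj hH hy with h5 | ⟨g, rfl, rfl⟩ | ⟨g, rfl, rfl⟩
    · exact ⟨h, hh, hu.imp h5.symm.trans h5.symm.trans⟩
    · refine ⟨g, ?_, Or.inr (Unsep.refl _ _)⟩
      rcases hu with hu | hu
      · simpa using K.mul_mem hh (h1 (mul_mem_classStab hu))
      · exact h4 g h hh hu
    · refine ⟨g, ?_, Or.inl (Unsep.refl _ _)⟩
      rcases hu with hu | hu
      · have := h3 (g⁻¹ * h) (by simpa [tr_tr] using hu.symm.tr g⁻¹)
        simpa using K.mul_mem hh (K.inv_mem this)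
      · simpa using K.mul_mem hh (h2 (mul_mem_classStab hu))
  have key2 : ∀ y, ∃ h ∈ K, Unsep H y (tr h z) ∨ Unsep H y (tr h z') := fun y => by
    have : y ∈ (Set.univ : Set (Vert n V)) := Set.mem_univ y
    rwa [← key] at this
  refine ⟨?_, fun y => (key2 y).imp fun h hh => hh.2⟩
  rw [eq_top_iff]
  intro g _
  obtain ⟨h, hh, hu | hu⟩ := key2 (tr g z)
  · simpa using K.mul_mem hh (h1 (mul_mem_classStab hu))
  · exact h4 g h hh hu

/-- The translation action on vertices. -/
abbrev vertAction (n : ℕ) (V : Type) : MulAction (FreeGroup (Fin n)) (Vert n V) where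
  smul := tr
  one_smul := tr_one
  mul_smul g h z := (tr_tr g h z).symm

/-- A separating edge gives an amalgam over the trivial group. -/
theorem isFreeFactorization_of_separating (hadj : T.Adj z z') (hH : IsHalf T.E z z' H)
    (hsep : ∀ g, ¬ Unsep H (tr g z) z') (hne : classStab H z' ≠ ⊥) :
    IsFreeFactorization ⊤ ![classStab H z, classStab H z'] := by
  let := vertAction n V
  refine isFreeFactorization_of_ping_pong (X := Hᶜ) (Y := H) ⟨z, hH.1⟩ ⟨z', hH.2.1⟩
    disjoint_compl_left (fun a ha h1 y hy => tr_notMem_of_mem_classStab hadj hH ha h1 hy)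
    (fun c hc h1 y hy => ?_) hne
    (eq_top_of_classStab_le hH le_sup_left le_sup_right fun g hg => (hsep g hg).elim).1
  rw [← classStab_compl] at hc
  exact not_not.mp (tr_notMem_of_mem_classStab (LabelledTree.Adj.symm hadj)
    (LabelledTree.isHalf_compl hH) hc h1 hy)

/-- After collapsing, the quotient graph is a loop: `t` conjugates the stabilizer at `z` to the one
at `z'`, and there is one orbit of classes. -/
theorem exists_unsep_of_nonseparating (hH : IsHalf T.E z z' H) {t : FreeGroup (Fin n)}
    (ht : Unsep H (tr t z) z') :
    classStab H z ⊔ Subgroup.zpowers t = ⊤ ∧ ∀ y, ∃ h, Unsep H y (tr h z) := by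
  have htm : t ∈ classStab H z ⊔ Subgroup.zpowers t :=
    Subgroup.mem_sup_right (Subgroup.mem_zpowers t)
  have hz' : classStab H z' ≤ classStab H z ⊔ Subgroup.zpowers t := fun g hg => by
    have h3 : t⁻¹ * (g * t) ∈ classStab H z := mul_mem_classStab (by
      have := (ht.tr g).trans (Unsep.trans hg ht.symm)
      rwa [tr_tr] at this)
    have h4 := Subgroup.mul_mem _ (Subgroup.mul_mem _ htm (Subgroup.mem_sup_left h3))
      (Subgroup.inv_mem _ htm)
    simpa [mul_assoc] using h4
  obtain ⟨h1, h2⟩ := eq_top_of_classStab_le hH le_sup_left hz' fun g hg => by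
    have h3 : t⁻¹ * g ∈ classStab H z := mul_mem_classStab (hg.trans ht.symm)
    simpa using Subgroup.mul_mem _ htm (Subgroup.mem_sup_left h3)
  refine ⟨h1, fun y => ?_⟩
  obtain ⟨h, hu | hu⟩ := h2 y
  · exact ⟨h, hu⟩
  · exact ⟨h * t, hu.trans (by simpa [tr_tr] using (ht.tr h).symm)⟩

/-- A nonseparating edge gives a free factorization with stable letter `t`. -/
theorem isFreeFactorization_of_nonseparating (hadj : T.Adj z z') (hH : IsHalf T.E z z' H)
    {t : FreeGroup (Fin n)} (ht : Unsep H (tr t z) z') :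
    IsFreeFactorization ⊤ ![classStab H z, Subgroup.zpowers t] := by
  have htA : t ∉ classStab H z := fun h => not_unsep hH (h.symm.trans ht)
  have hadj' := LabelledTree.Adj.symm hadj
  have hHc := LabelledTree.isHalf_compl hH
  have htz : tr t z ∈ H := ht.mem_iff.mpr hH.2.1
  -- The element `t * a` takes `z` into the class of `z'`, so the translated edge starts inside `H`.
  -- The half space beyond it is disjoint from `Hᶜ`, unless the translated edge is `z z'` reversed;
  -- then `t * a` would have order two, which is impossible.
  have hAH : ∀ a ∈ classStab H z, ∀ y ∈ H, tr t (tr a y) ∈ H := by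
    intro a ha
    have hat : t * a ≠ 1 := fun h => by
      have : t = a⁻¹ := eq_inv_of_mul_eq_one_left h
      exact htA (this ▸ Subgroup.inv_mem _ ha)
    have h3 : Unsep H (tr (t * a) z) z' := by
      have := (Unsep.tr (mem_classStab.mp ha) t).trans ht
      rwa [tr_tr] at this
    intro y hy
    have hd := LabelledTree.isHalf_disjoint hadj' (hadj.tr (t * a)) hHc (hH.tr (t * a))
      (fun h => hH.1 (h3.inv_tr.mem_iff.mpr h)) (fun h => h (h3.mem_iff.mpr hH.2.1))
      (fun h => by
        have e1 : z = tr (t * a) z' := congrArg Prod.snd h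
        have e2 : z' = tr (t * a) z := congrArg Prod.fst h
        have e3 : tr 1 z' = tr ((t * a) * (t * a)) z' := by
          rw [← tr_tr, ← e1, ← e2, tr_one]
        have e4 := (tr_left_injective e3).symm
        exact not_isOfFinOrder_of_isMulTorsionFree hat
          (isOfFinOrder_iff_pow_eq_one.mpr ⟨2, by norm_num, by rw [pow_two, e4]⟩))
    by_contra h
    rw [tr_tr] at h
    exact Set.disjoint_left.mp hd h (show tr (t * a)⁻¹ (tr (t * a) y) ∈ H by rwa [tr_inv_tr])
  have htH : ∀ y ∈ H, tr t y ∈ H := fun y hy => by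
    simpa using hAH 1 (Subgroup.one_mem _) y hy
  have hpow : ∀ k : ℕ, ∀ y ∈ H, tr (t ^ k) y ∈ H := by
    intro k
    induction k with
    | zero => intro y hy; simpa using hy
    | succ k ih => intro y hy; rw [pow_succ, ← tr_tr]; exact ih _ (htH y hy)
  have ht1 : t ≠ 1 := fun h => htA (h ▸ Subgroup.one_mem _)
  let := vertAction n V
  -- `X` is the region between the edge and its translate by `t⁻¹`, and `Y` is its complement.
  refine isFreeFactorization_of_ping_pong (X := {y | y ∉ H ∧ tr t y ∈ H})
    (Y := {y | y ∈ H ∨ tr t y ∉ H}) ⟨z, hH.1, htz⟩ ⟨z', Or.inl hH.2.1⟩ ?_ ?_ ?_ ?_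
    (exists_unsep_of_nonseparating hH ht).1
  · rw [Set.disjoint_left]
    rintro y ⟨h1, h2⟩ (h3 | h3)
    · exact h1 h3
    · exact h3 h2
  · rintro a ha h1 y (hy | hy)
    · exact ⟨tr_notMem_of_mem_classStab hadj hH ha h1 hy, hAH a ha y hy⟩
    · constructor
      · intro h2
        have h3 := hAH a⁻¹ (Subgroup.inv_mem _ ha) (tr a y) h2
        rw [tr_inv_tr] at h3
        exact hy h3
      · by_contra h2
        have ha' : t * a * t⁻¹ ∈ classStab Hᶜ z' := by
          rw [classStab_compl]
          have h3 : Unsep H (tr (t * a * t⁻¹) (tr t z)) (tr t z) := by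
            have := Unsep.tr (mem_classStab.mp ha) t
            rw [tr_tr] at this ⊢
            simpa using this
          exact (Unsep.tr ht _).symm.trans (h3.trans ht)
        refine tr_notMem_of_mem_classStab hadj' hHc ha' (fun h => h1 ?_) (y := tr t y) hy ?_
        · simpa using h
        · rw [tr_tr]
          have h3 : tr t (tr a y) ∉ H := h2
          simpa [tr_tr] using h3
  · rintro c ⟨k, rfl⟩ hk x ⟨h1, h2⟩
    obtain ⟨m, rfl | rfl⟩ := k.eq_nat_or_neg
    · cases m with
      | zero => simp at hk
      | succ m =>
        left
        have := hpow m _ h2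
        rw [tr_tr, ← pow_succ] at this
        change tr (t ^ ((m + 1 : ℕ) : ℤ)) x ∈ H
        rwa [zpow_natCast]
    · cases m with
      | zero => simp at hk
      | succ m =>
        right
        intro h3
        apply h1
        change tr t (tr (t ^ (-((m + 1 : ℕ) : ℤ))) x) ∈ H at h3
        have := hpow m _ h3
        rw [tr_tr, tr_tr, ← pow_succ, zpow_neg, zpow_natCast, mul_inv_cancel,
          tr_one] at this
        exact this
  · exact fun h => ht1 (Subgroup.zpowers_eq_bot.mp h)

/-- The class stabilizer of an endpoint of a separating edge is nontrivial if an infinite path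
starts there in another direction. -/
theorem classStab_ne_bot [Finite V] (hH : IsHalf T.E z z' H)
    (hsep : ∀ g, ¬ Unsep H (tr g z) z') {y : ℕ → Vert n V} (hy0 : y 0 = z) (hy1 : y 1 ≠ z')
    (hadj : ∀ i, T.Adj (y i) (y (i + 1))) (hinj : Function.Injective fun i => (y i).1) :
    classStab H z ≠ ⊥ := by
  intro hbot
  have hz : ∀ i, Unsep H (y i) z := by
    intro i
    induction i with
    | zero => rw [hy0]; exact Unsep.refl _ _
    | succ i ih =>
      rcases unsep_or_of_adj hH (hadj i) with h | ⟨g, h1, h2⟩ | ⟨g, h1, h2⟩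
      · exact h.symm.trans ih
      · rw [h1] at ih
        have hg : g ∈ classStab H z := ih
        rw [hbot, Subgroup.mem_bot] at hg
        rw [hg, tr_one] at h1 h2
        have : i = 0 := hinj (by simp [h1, hy0])
        subst this
        exact (hy1 h2).elim
      · rw [h1] at ih
        exact (hsep g⁻¹ ih.inv_tr.symm).elim
  -- With trivial stabilizer the path never leaves its class. Two of its vertices have the same
  -- `V`-label, so a nontrivial translation maps one to the other and preserves the class.
  obtain ⟨i, j, hij, he⟩ := Finite.exists_ne_map_eq_of_infinite fun i => (y i).2
  have h1 : tr ((y j).1 * (y i).1⁻¹) (y i) = y j := by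
    refine Prod.ext ?_ he
    simp [tr]
  have h2 : (y j).1 * (y i).1⁻¹ ∈ classStab H z := by
    have := (hz i).symm.tr ((y j).1 * (y i).1⁻¹)
    rw [h1] at this
    exact this.trans (hz j)
  rw [hbot, Subgroup.mem_bot, mul_inv_eq_one] at h2
  exact hij (hinj h2.symm)

theorem isPrefix_ofFn (ξ : Boundary n) (m k : ℕ) :
    (List.ofFn fun i : Fin m => ξ.1 i) <+: List.ofFn fun i : Fin (m + k) => ξ.1 i := by
  induction k with
  | zero => exact List.prefix_rfl
  | succ k ih =>
    refine ih.trans ?_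
    rw [← add_assoc, List.ofFn_succ', List.concat_eq_append]
    exact List.prefix_append _ _

/-- A ray that stays in one class ends in the boundary of its stabilizer. -/
theorem mem_boundaryOf_classStab [Finite V] {ξ : Boundary n} {y : Vert n V} {u : ℕ → V} {k : ℕ}
    (h : ∀ i, k ≤ i → Unsep H (pre ξ i, u i) y) : ξ ∈ boundaryOf (classStab H y) := by
  classical
  -- One representative of the class for each label in `V`; the value `1` is an unused default.
  -- Finitely many representatives have bounded length.
  have hr : ∀ w : V, ∃ r : FreeGroup (Fin n), (∃ g, Unsep H (g, w) y) → Unsep H (r, w) y := by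
    intro w
    by_cases hw : ∃ g, Unsep H (g, w) y
    · exact ⟨hw.choose, fun _ => hw.choose_spec⟩
    · exact ⟨1, fun h => (hw h).elim⟩
  choose r hr using hr
  obtain ⟨M, hM⟩ := (Set.finite_range fun w => (r w)⁻¹.norm).bddAbove
  intro m
  -- From `k` on the ray is in the class; `M` further letters absorb what the representative can
  -- cancel.
  set i := m + (M + k) with hi
  have h1 := h i (by omega)
  have h2 := hr (u i) ⟨_, h1⟩
  refine ⟨pre ξ i * (r (u i))⁻¹, ?_, ?_⟩
  · have h3 := h2.tr (pre ξ i * (r (u i))⁻¹)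
    have h4 : tr (pre ξ i * (r (u i))⁻¹) ((r (u i), u i) : Vert n V) = (pre ξ i, u i) := by
      simp [tr]
    rw [h4] at h3
    exact h3.symm.trans h1
  · refine prefix_toWord_mul _ _ _ ?_ ?_
    · rw [toWord_pre]
      exact isPrefix_ofFn ξ m (M + k)
    · have h5 : (r (u i))⁻¹.norm ≤ M := hM ⟨u i, rfl⟩
      rw [norm_pre, List.length_ofFn]
      omega

end Splitting

end FreeLines

namespace FreeLines

open Filter
open scoped Pointwise

variable {n : ℕ} {V : Type}

/-! ### Filling sets cross every edge -/

theorem exists_rep (ℓ : Line n) : ∃ p : EndpointPair n, Line.mk p = ℓ := Quotient.exists_rep ℓ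

theorem exists_pointed_mem_lifts {B : Set (Line n)} {ℓ : Line n} (hℓ : ℓ ∈ B) :
    ∃ p ∈ lifts B, Pointed p ∧ ∃ h : p.1 ≠ p.2, Line.mk ⟨p, h⟩ = ℓ := by
  obtain ⟨⟨p, hp⟩, rfl⟩ := exists_rep ℓ
  obtain ⟨g, hg⟩ := exists_pointed_smul hp
  have h : p ∈ lifts B := ⟨hp, hℓ⟩
  obtain ⟨h1, h2⟩ := smul_mem_lifts h g
  exact ⟨g • p, ⟨h1, h2⟩, hg, h1, line_mk_smul g p hp h1⟩

theorem exists_mul_ne_mul (hn : 2 ≤ n) : ∃ a b : FreeGroup (Fin n), a * b ≠ b * a := by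
  refine ⟨FreeGroup.of ⟨0, by omega⟩, FreeGroup.of ⟨1, by omega⟩, fun h => ?_⟩
  have := congrArg FreeGroup.toWord h
  simp [FreeGroup.toWord_mul, FreeGroup.reduce.cons] at this

namespace LineMap

variable {T : LabelledTree n V} {B : Set (Line n)} (φ : LineMap T B)

theorem crosses_of_vert {B' : Set (Line n)} {p : Boundary n × Boundary n}
    (hp : p ∈ lifts B') (h : Pointed p) {i : ℕ} {g : FreeGroup (Fin n)} {s : Letter n} {u w : V}
    (h1 : φ.vert p i = tr g (1, u)) (h2 : φ.vert p (i + 1) = tr g (nbr (s, w))) :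
    φ.Crosses B' s u w := by
  refine ⟨shift p i, shift_mem_lifts hp i, h.shift i, congrArg Prod.snd h1, Prod.ext ?_ ?_⟩
  · have e1 : pre p.1 i = g := by simpa [vert, tr] using congrArg Prod.fst h1
    have e2 : pre p.1 (i + 1) = g * gen s := congrArg Prod.fst h2
    rw [pre_succ, e1] at e2
    change (shift p i).1.1 0 = s
    rw [shift_fst_apply]
    exact gen_injective (mul_left_cancel e2)
  · have e3 : φ.lam (shift p (i + 1)) = w := congrArg Prod.snd h2
    rwa [shift_succ] at e3

/-- A lift could leave its class only through a translate of the edge, in one of its orientations;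
either would be a crossing. -/
theorem unsep_vert {B' : Set (Line n)} (hB : B' ⊆ B) {s : Letter n} {u w : V} (hE : T.E s u w)
    (hc : ¬ φ.Crosses B' s u w) {p : Boundary n × Boundary n} (hp : p ∈ lifts B')
    (h : Pointed p) (i : ℕ) :
    Unsep (T.half (1, u) (nbr (s, w))) (φ.vert p i) (1, φ.lam p) := by
  have hH := LabelledTree.isHalf_half (adj_nbr (d := (s, w)) hE)
  induction i with
  | zero => rw [vert_zero]; exact Unsep.refl _ _
  | succ i ih =>
    rcases unsep_or_of_adj hH (φ.vert_adj (lifts_mono hB hp) h i) with h1 | ⟨g, h1, h2⟩ | ⟨g, h1, h2⟩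
    · exact h1.symm.trans ih
    · exact (hc (φ.crosses_of_vert hp h h1 h2)).elim
    · have h3 : φ.Crosses B' s.inv w u := by
        refine φ.crosses_of_vert (i := i) (g := g * gen s) hp h ?_ ?_
        · rw [h1]; simp [tr, nbr]
        · rw [h2]; simp [tr, nbr, gen_inv]
      have h4 := h3.symm hB
      rw [Letter.inv_inv] at h4
      exact (hc h4).elim

/-- A line that does not cross the orbit of an edge is carried by the stabilizer of a class. -/
theorem exists_lift_of_not_crosses [Finite V] {B' : Set (Line n)} (hB : B' ⊆ B) {s : Letter n}
    {u w : V} (hE : T.E s u w) (hc : ¬ φ.Crosses B' s u w) {p : Boundary n × Boundary n}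
    (hp : p ∈ lifts B') (h : Pointed p) {y : Vert n V} {g : FreeGroup (Fin n)}
    (hy : Unsep (T.half (1, u) (nbr (s, w))) (1, φ.lam p) (tr g y)) :
    (g⁻¹ • p).1 ∈ boundaryOf (classStab (T.half (1, u) (nbr (s, w))) y) ∧
      (g⁻¹ • p).2 ∈ boundaryOf (classStab (T.half (1, u) (nbr (s, w))) y) := by
  have key : ∀ q ∈ lifts B', Pointed q →
      Unsep (T.half (1, u) (nbr (s, w))) (1, φ.lam q) (tr g y) →
      (g⁻¹ • q.1) ∈ boundaryOf (classStab (T.half (1, u) (nbr (s, w))) y) := by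
    intro q hq hqp hqy
    obtain ⟨j, k, hjk⟩ := exists_pre_smul g⁻¹ q.1
    refine mem_boundaryOf_classStab (k := j) (u := fun i => φ.lam (shift q (k + (i - j)))) ?_
    intro i hi
    obtain ⟨l, rfl⟩ := Nat.exists_eq_add_of_le hi
    have h1 := ((φ.unsep_vert hB hE hc hq hqp (k + l)).trans hqy).tr g⁻¹
    rw [tr_inv_tr] at h1
    simpa [vert, tr, hjk] using h1
  refine ⟨key p hp h hy, key p.swap (swap_mem_lifts hp) h.swap ?_⟩
  rwa [φ.lam_swap p (lifts_mono hB hp) h]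

end LineMap

theorem exists_conjClass_top_of_isFilling {B : Set (Line n)} (h : IsFilling B)
    {𝒜 : Set (SubgroupClass (FreeGroup (Fin n)))} (h𝒜 : IsFreeFactorSystem 𝒜)
    (hc : ∀ ℓ ∈ B, Carries 𝒜 ℓ) : conjClass ⊤ ∈ 𝒜 := by
  obtain ⟨A', h1, h2⟩ := h.2.1 𝒜 ⟨h𝒜, hc⟩ ⊤ rfl
  rwa [eq_top_of_isFreeFactor_top h2] at h1

/-- An uncrossed edge orbit gives a free splitting with trivial edge group, and every line of `B'`
has its ends in a conjugate of a vertex group. The vertex groups are nontrivial and proper, contrary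
to filling. Visits by all of `B`, not only by `B'`, serve to show nontriviality. -/
theorem LineMap.crosses_of_isFilling (hn : 2 ≤ n) [Finite V] {T : LabelledTree n V}
    {B : Set (Line n)} (φ : LineMap T B)
    (hvis : ∀ v, ∃ p ∈ lifts B, Pointed p ∧ φ.lam p = v) {B' : Set (Line n)} (hB : B' ⊆ B)
    (hfill : IsFilling B') {s : Letter n} {u w : V} (hE : T.E s u w) : φ.Crosses B' s u w := by
  by_contra hc
  set z : Vert n V := (1, u) with hz
  set z' : Vert n V := nbr (s, w) with hz'
  set H := T.half z z' with hHdef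
  have hadj : T.Adj z z' := adj_nbr (d := (s, w)) hE
  have hH : IsHalf T.E z z' H := LabelledTree.isHalf_half hadj
  by_cases hsep : ∃ t, Unsep H (tr t z) z'
  · obtain ⟨t, ht⟩ := hsep
    have hF := isFreeFactorization_of_nonseparating hadj hH ht
    have htop := exists_unsep_of_nonseparating hH ht
    have hbot : classStab H z ≠ ⊥ := by
      intro h0
      -- A trivial vertex group would make `F_n` cyclic, which `2 ≤ n` excludes.
      obtain ⟨a, b, hab⟩ := exists_mul_ne_mul hn
      have h1 := htop.1
      rw [h0, bot_sup_eq, Subgroup.eq_top_iff'] at h1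
      obtain ⟨i, rfl⟩ := h1 a
      obtain ⟨j, rfl⟩ := h1 b
      exact hab ((Commute.refl t).zpow_zpow i j)
    have hFF : IsFreeFactorSystem {conjClass (classStab H z)} := by
      refine ⟨⟨Set.finite_singleton _, fun A hA => ?_⟩, 1, fun _ => classStab H z,
        Subgroup.zpowers t, ?_, ?_⟩
      · exact ne_bot_and_fg_of_conjClass_eq hA hbot (hF.fg 0)
      · simp
      · convert hF using 1
        funext i
        fin_cases i <;> rfl
    have h1 := exists_conjClass_top_of_isFilling hfill hFF fun ℓ hℓ => by
      obtain ⟨p, hp, hpp, hne, rfl⟩ := exists_pointed_mem_lifts hℓ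
      obtain ⟨g, hg⟩ := htop.2 (1, φ.lam p)
      have h2 := φ.exists_lift_of_not_crosses hB hE hc hp hpp hg
      obtain ⟨h3, -⟩ := smul_mem_lifts hp g⁻¹
      exact ⟨_, rfl, ⟨g⁻¹ • p, h3⟩, line_mk_smul _ _ hne h3, h2⟩
    have h2 : t ∈ classStab H z := conjClass_eq_top h1 ▸ Subgroup.mem_top t
    exact not_unsep hH (h2.symm.trans ht)
  · push Not at hsep
    have hsep' : ∀ g, ¬ Unsep Hᶜ (tr g z') z := fun g hg =>
      hsep g⁻¹ (unsep_compl.mp hg).inv_tr.symm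
    have hHc := LabelledTree.isHalf_compl hH
    have hA : classStab H z ≠ ⊥ := by
      obtain ⟨p, hp, hpp, hu⟩ := hvis u
      have key : ∀ q ∈ lifts B, Pointed q → φ.lam q = u → φ.dir q ≠ (s, w) →
          classStab H z ≠ ⊥ := fun q hq hqp hqu hd => by
        refine classStab_ne_bot hH hsep (y := φ.vert q) ?_ ?_ (φ.vert_adj hq hqp)
          (pre_injective q.1)
        · rw [LineMap.vert_zero, hqu]
        · rw [LineMap.vert_one]
          intro h
          have h2 : (φ.dir q).2 = w := congrArg Prod.snd h
          exact hd (Prod.ext (gen_injective (congrArg Prod.fst h)) h2)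
      -- The two orientations of a line leave `u` in different directions, so one of them avoids the
      -- edge.
      by_cases hd : φ.dir p = (s, w)
      · refine key p.swap (swap_mem_lifts hp) hpp.swap ?_ fun h => ?_
        · rw [φ.lam_swap p hp hpp, hu]
        · exact φ.dir_swap_ne hpp (hd.trans h.symm)
      · exact key p hp hpp hu hd
    have hA' : classStab H z' ≠ ⊥ := by
      rw [← classStab_compl]
      obtain ⟨p, hp, hpp, hu⟩ := hvis w
      have key : ∀ q ∈ lifts B, Pointed q → φ.lam q = w → φ.dir q ≠ (s.inv, u) →
          classStab Hᶜ z' ≠ ⊥ := fun q hq hqp hqu hd => by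
        refine classStab_ne_bot hHc hsep' (y := fun i => tr (gen s) (φ.vert q i)) ?_ ?_
          (fun i => (φ.vert_adj hq hqp i).tr _) ?_
        · rw [LineMap.vert_zero, hqu, hz']
          simp [tr, nbr]
        · rw [LineMap.vert_one, hz]
          intro h
          have h2 : (φ.dir q).2 = u := congrArg Prod.snd h
          refine hd (Prod.ext (gen_injective ?_) h2)
          rw [gen_inv]
          exact eq_inv_of_mul_eq_one_right (congrArg Prod.fst h)
        · intro i j hij
          exact pre_injective q.1 (mul_left_cancel hij)
      by_cases hd : φ.dir p = (s.inv, u)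
      · refine key p.swap (swap_mem_lifts hp) hpp.swap ?_ fun h => ?_
        · rw [φ.lam_swap p hp hpp, hu]
        · exact φ.dir_swap_ne hpp (hd.trans h.symm)
      · exact key p hp hpp hu hd
    have hF := isFreeFactorization_of_separating hadj hH hsep hA'
    have hFF : IsFreeFactorSystem {conjClass (classStab H z), conjClass (classStab H z')} := by
      refine ⟨⟨Set.toFinite _, fun A hA => ?_⟩, 2, ![classStab H z, classStab H z'], ⊥, ?_,
        hF.snoc_bot⟩
      · rcases hA with hA1 | hA1
        · exact ne_bot_and_fg_of_conjClass_eq hA1 hA (hF.fg 0)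
        · exact ne_bot_and_fg_of_conjClass_eq hA1 hA' (hF.fg 1)
      · ext c
        simp [Fin.exists_fin_two, eq_comm]
    have hcov := (eq_top_of_classStab_le hH (K := ⊤) le_top le_top
      fun _ _ => Subgroup.mem_top _).2
    have h1 := exists_conjClass_top_of_isFilling hfill hFF fun ℓ hℓ => by
      obtain ⟨p, hp, hpp, hne, rfl⟩ := exists_pointed_mem_lifts hℓ
      obtain ⟨g, hg⟩ := hcov (1, φ.lam p)
      obtain ⟨h3, -⟩ := smul_mem_lifts hp g⁻¹
      rcases hg with hg | hg
      · exact ⟨_, Or.inl rfl, ⟨g⁻¹ • p, h3⟩, line_mk_smul _ _ hne h3,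
          φ.exists_lift_of_not_crosses hB hE hc hp hpp hg⟩
      · exact ⟨_, Or.inr rfl, ⟨g⁻¹ • p, h3⟩, line_mk_smul _ _ hne h3,
          φ.exists_lift_of_not_crosses hB hE hc hp hpp hg⟩
    -- The two vertex groups are nontrivial and meet trivially, so neither is `F_n`.
    have hdisj : ∀ a ∈ classStab H z, a ∈ classStab H z' → a = 1 := by
      intro a ha ha'
      by_contra ha1
      exact tr_notMem_of_mem_classStab hadj hH ha ha1 hH.2.1 ((Unsep.mem_iff ha').mpr hH.2.1)
    rcases h1 with h1 | h1
    · obtain ⟨a, ha, ha1⟩ := (classStab H z').bot_or_exists_ne_one.resolve_left hA'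
      exact ha1 (hdisj a (conjClass_eq_top h1 ▸ Subgroup.mem_top a) ha)
    · obtain ⟨a, ha, ha1⟩ := (classStab H z).bot_or_exists_ne_one.resolve_left hA
      exact ha1 (hdisj a ha (conjClass_eq_top h1 ▸ Subgroup.mem_top a))

end FreeLines

namespace FreeLines

open Filter

variable {n : ℕ} {V : Type}

/-! ### Unfolding a tree at a cut direction -/

/-- The projection that identifies the new vertex `none` with `v`. -/
def proj (v : V) (a : Option V) : V := a.getD v

/-- The directions at `v` that stay attached to each vertex of the unfolded graph: those of `X`
and `x` at the new vertex `none`, those outside `X` at `v`. -/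
def Attached (v : V) (x : Letter n × V) (X : Set (Letter n × V)) :
    Option V → Letter n × V → Prop
  | none, d => d ∈ X ∨ d = x
  | some u, d => u = v → d ∉ X

/-- The edges of the unfolded graph. -/
def unfoldEdge (T : LabelledTree n V) (v : V) (x : Letter n × V) (X : Set (Letter n × V))
    (t : Letter n) (a b : Option V) : Prop :=
  T.E t (proj v a) (proj v b) ∧ Attached v x X a (t, proj v b) ∧
    Attached v x X b (t.inv, proj v a)

section Unfold

variable {T : LabelledTree n V} {v : V} {x : Letter n × V} {X : Set (Letter n × V)}

/-- Only the direction `x` at `v` is attached to both copies of `v`. -/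
theorem Attached.unique {a a' : Option V} {d : Letter n × V} (h : Attached v x X a d)
    (h' : Attached v x X a' d) (hp : proj v a = proj v a') (hd : proj v a = v → d ≠ x) :
    a = a' := by
  cases a with
  | none =>
    cases a' with
    | none => rfl
    | some u =>
      have hu : u = v := hp.symm
      exact (h.elim (h' hu) (hd rfl)).elim
  | some u =>
    cases a' with
    | none =>
      have hu : u = v := hp
      exact (h'.elim (h hu) (hd hu)).elim
    | some u' => exact congrArg some hp

theorem exists_attached (v : V) (x : Letter n × V) (X : Set (Letter n × V)) (u : V)
    (d : Letter n × V) : ∃ a, proj v a = u ∧ Attached v x X a d := by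
  by_cases h : u = v ∧ d ∈ X
  · exact ⟨none, h.1.symm, Or.inl h.2⟩
  · exact ⟨some u, rfl, fun h1 h2 => h ⟨h1, h2⟩⟩

theorem unfoldEdge_symm {t : Letter n} {a b : Option V} (h : unfoldEdge T v x X t a b) :
    unfoldEdge T v x X t.inv b a := by
  refine ⟨T.symm h.1, h.2.2, ?_⟩
  rw [Letter.inv_inv]
  exact h.2.1

/-- The folding map on vertices. -/
def foldVert (v : V) (y : Vert n (Option V)) : Vert n V := (y.1, proj v y.2)

theorem fst_eq_of_foldVert {y : Vert n (Option V)} {z : Vert n V} (h : foldVert v y = z) :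
    y.1 = z.1 := congrArg Prod.fst h

theorem snd_eq_of_foldVert {y : Vert n (Option V)} {z : Vert n V} (h : foldVert v y = z) :
    proj v y.2 = z.2 := congrArg Prod.snd h

theorem foldVert_adj {y y' : Vert n (Option V)} (h : EdgeAdj (unfoldEdge T v x X) y y') :
    T.Adj (foldVert v y) (foldVert v y') := by
  obtain ⟨s, h1, h2⟩ := h
  exact ⟨s, h1, h2.1⟩

/-- The two copies of `v` in a fibre have a common neighbour across `x`. A set closed under
adjacency is thus a union of fibres of the folding map, and its image is closed under adjacency in
`T`. -/
theorem unfold_conn (hx : T.E x.1 v x.2) (hxX : x ∉ X) (H : Set (Vert n (Option V)))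
    (hcl : ∀ z z', EdgeAdj (unfoldEdge T v x X) z z' → z ∈ H → z' ∈ H) (hne : H.Nonempty) :
    H = Set.univ := by
  have hiff : ∀ z z', EdgeAdj (unfoldEdge T v x X) z z' → (z ∈ H ↔ z' ∈ H) := fun z z' h =>
    ⟨hcl z z' h, hcl z' z (h.symm unfoldEdge_symm)⟩
  have hnone : ∀ g : FreeGroup (Fin n), (g, none) ∈ H ↔ (g, some v) ∈ H := by
    intro g
    obtain ⟨b, hb, hb2⟩ := exists_attached v x X x.2 (x.1.inv, v)
    have h1 : unfoldEdge T v x X x.1 none b :=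
      ⟨by rw [hb]; exact hx, Or.inr (by rw [hb]), hb2⟩
    have h2 : unfoldEdge T v x X x.1 (some v) b :=
      ⟨by rw [hb]; exact hx, fun _ => by rwa [hb], hb2⟩
    exact (hiff (g, none) (g * gen x.1, b) ⟨x.1, rfl, h1⟩).trans
      (hiff (g, some v) (g * gen x.1, b) ⟨x.1, rfl, h2⟩).symm
  have hfib : ∀ y : Vert n (Option V), y ∈ H ↔ (y.1, some (proj v y.2)) ∈ H := by
    rintro ⟨g, _ | u⟩
    · exact hnone g
    · exact Iff.rfl
  have hfib2 : ∀ y y' : Vert n (Option V), foldVert v y = foldVert v y' → y ∈ H → y' ∈ H := by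
    intro y y' h hy
    rw [hfib] at hy ⊢
    have h1 : y.1 = y'.1 := fst_eq_of_foldVert h
    have h2 : proj v y.2 = proj v y'.2 := snd_eq_of_foldVert h
    rwa [← h1, ← h2]
  have key : foldVert v '' H = Set.univ := by
    refine T.conn _ ?_ (hne.image _)
    rintro _ z' ⟨s, h1, h2⟩ ⟨y, hy, rfl⟩
    obtain ⟨a, ha, ha2⟩ := exists_attached v x X (proj v y.2) (s, z'.2)
    obtain ⟨b, hb, hb2⟩ := exists_attached v x X z'.2 (s.inv, proj v y.2)
    refine ⟨(z'.1, b), hcl (y.1, a) _ ⟨s, h1, ?_, ?_, ?_⟩ (hfib2 y _ ?_ hy), ?_⟩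
    · change T.E s (proj v a) (proj v b)
      rw [ha, hb]; exact h2
    · change Attached v x X a (s, proj v b)
      rwa [hb]
    · change Attached v x X b (s.inv, proj v a)
      rwa [ha]
    · simp [foldVert, ha]
    · simp [foldVert, hb]
  rw [Set.eq_univ_iff_forall]
  intro y
  obtain ⟨y', hy', he⟩ : foldVert v y ∈ foldVert v '' H := key ▸ Set.mem_univ _
  exact hfib2 y' y he hy'

theorem unfold_isHalf_of_cut {z z' : Vert n (Option V)} {s : Letter n}
    (h1 : z'.1 = z.1 * gen s) (h2 : unfoldEdge T v x X s z.2 z'.2) (hv : proj v z.2 = v)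
    (hd : (s, proj v z'.2) = x) : ∃ H, IsHalf (unfoldEdge T v x X) z z' H := by
  -- The side of `z`: `z` itself and everything that folds beyond a direction other than `x`
  -- attached to it. The preimage of a half space of `T` would not do, as both copies of the edge
  -- `x` cross into it.
  let Z : Set (Vert n (Option V)) := {y | y = z ∨ ∃ d : Letter n × V, d ≠ x ∧ T.E d.1 v d.2 ∧
    Attached v x X z.2 d ∧ foldVert v y ∈ T.half (z.1, v) (z.1 * gen d.1, d.2)}
  have hhalf : ∀ d : Letter n × V, T.E d.1 v d.2 →
      IsHalf T.E (z.1, v) (z.1 * gen d.1, d.2) (T.half (z.1, v) (z.1 * gen d.1, d.2)) :=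
    fun d hd => LabelledTree.isHalf_half ⟨d.1, rfl, hd⟩
  have hfz : foldVert v z = (z.1, v) := by rw [foldVert, hv]
  refine ⟨Zᶜ, fun h => h (Or.inl rfl), ?_, ?_⟩
  · rintro (h | ⟨d, hdx, hdE, -, h⟩)
    · rw [h] at h1
      exact gen_ne_one s (by simpa using h1)
    · have hH := hhalf d hdE
      have h3 := (hH.2.2 (z.1, v) (foldVert v z') (hfz ▸ foldVert_adj ⟨s, h1, h2⟩) hH.1 h).2
      have e1 : z'.1 = z.1 * gen d.1 := fst_eq_of_foldVert h3
      have e2 : proj v z'.2 = d.2 := snd_eq_of_foldVert h3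
      rw [h1] at e1
      apply hdx
      rw [← hd, e2, gen_injective (mul_left_cancel e1)]
  · intro y y' hy hyZ hy'Z
    rcases not_not.mp hyZ with rfl | ⟨d, hdx, hdE, hdA, h⟩
    · refine ⟨rfl, ?_⟩
      obtain ⟨t, e1, e2⟩ := hy
      by_cases hdt : (t, proj v y'.2) = x
      · have ht : t = s := (congrArg Prod.fst hdt).trans (congrArg Prod.fst hd).symm
        subst ht
        have hp : proj v y'.2 = proj v z'.2 :=
          (congrArg Prod.snd hdt).trans (congrArg Prod.snd hd).symm
        refine Prod.ext (e1.trans h1.symm) (Attached.unique e2.2.2 h2.2.2 hp fun _ h3 => ?_)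
        exact Letter.inv_ne t ((congrArg Prod.fst h3).trans (congrArg Prod.fst hdt).symm)
      · refine (hy'Z (Or.inr ⟨_, hdt, ?_, e2.2.1, ?_⟩)).elim
        · have := e2.1
          rwa [hv] at this
        · have hE : T.E t v (proj v y'.2) := by
            have := e2.1
            rwa [hv] at this
          have := (hhalf (t, proj v y'.2) hE).2.1
          rwa [foldVert, e1]
    · have hH := hhalf d hdE
      have h3 : foldVert v y' ∉ T.half (z.1, v) (z.1 * gen d.1, d.2) := fun h4 =>
        hy'Z (Or.inr ⟨d, hdx, hdE, hdA, h4⟩)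
      obtain ⟨e1, e2⟩ := hH.2.2 _ _ (LabelledTree.Adj.symm (foldVert_adj hy)) h3 h
      obtain ⟨t, f1, f2⟩ := hy.symm unfoldEdge_symm
      have e3 : y'.1 = z.1 := fst_eq_of_foldVert e1
      have e4 : proj v y'.2 = v := snd_eq_of_foldVert e1
      have e5 : y.1 = z.1 * gen d.1 := fst_eq_of_foldVert e2
      have e6 : proj v y.2 = d.2 := snd_eq_of_foldVert e2
      rw [e5, e3] at f1
      have ht : d.1 = t := gen_injective (mul_left_cancel f1)
      have hA := f2.2.1
      rw [e6, ← ht] at hA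
      have h5 : y'.2 = z.2 := Attached.unique hA hdA (e4.trans hv.symm) fun _ => hdx
      exact (hy'Z (Or.inl (Prod.ext e3 h5))).elim

/-- An edge that is not a copy of `x` is the only edge over its image, so the preimage of a half
space of `T` works. Copies of `x`, in either orientation, are covered by `unfold_isHalf_of_cut`. -/
theorem unfold_bridge (z z' : Vert n (Option V)) (h : EdgeAdj (unfoldEdge T v x X) z z') :
    ∃ H, IsHalf (unfoldEdge T v x X) z z' H := by
  obtain ⟨s, h1, h2⟩ := h
  by_cases hc : proj v z.2 = v ∧ (s, proj v z'.2) = x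
  · exact unfold_isHalf_of_cut h1 h2 hc.1 hc.2
  by_cases hc' : proj v z'.2 = v ∧ (s.inv, proj v z.2) = x
  · obtain ⟨H, hH⟩ := unfold_isHalf_of_cut (z := z') (z' := z) (s := s.inv)
      (by rw [h1, gen_inv, mul_inv_cancel_right]) (unfoldEdge_symm h2) hc'.1 hc'.2
    exact ⟨_, hH.compl unfoldEdge_symm⟩
  have hH := LabelledTree.isHalf_half (foldVert_adj ⟨s, h1, h2⟩)
  refine ⟨{y | foldVert v y ∈ T.half (foldVert v z) (foldVert v z')}, hH.1, hH.2.1, ?_⟩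
  intro y y' hy h3 h4
  obtain ⟨e1, e2⟩ := hH.2.2 _ _ (foldVert_adj hy) h3 h4
  obtain ⟨t, f1, f2⟩ := hy
  have g1 : y.1 = z.1 := fst_eq_of_foldVert e1
  have g2 : proj v y.2 = proj v z.2 := snd_eq_of_foldVert e1
  have g3 : y'.1 = z'.1 := fst_eq_of_foldVert e2
  have g4 : proj v y'.2 = proj v z'.2 := snd_eq_of_foldVert e2
  rw [g1, g3, h1] at f1
  have ht : s = t := gen_injective (mul_left_cancel f1)
  subst ht
  have k1 := f2.2.1
  have k2 := f2.2.2
  rw [g4] at k1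
  rw [g2] at k2
  refine ⟨Prod.ext g1 (Attached.unique k1 h2.2.1 g2 fun h5 h6 => hc ⟨g2 ▸ h5, h6⟩),
    Prod.ext g3 (Attached.unique k2 h2.2.2 g4 fun h5 h6 => hc' ⟨g4 ▸ h5, h6⟩)⟩

variable (T v x X) in
/-- Unfolding: the vertex `v` is divided in two, each with a copy of the edge `x`. -/
def LabelledTree.unfold (hx : T.E x.1 v x.2) (hxX : x ∉ X) : LabelledTree n (Option V) where
  E := unfoldEdge T v x X
  symm := unfoldEdge_symm
  conn := unfold_conn hx hxX
  bridge := unfold_bridge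

variable {B : Set (Line n)} (φ : LineMap T B)

variable (v X) in
open Classical in
/-- The lifts of lines to the unfolded tree. -/
noncomputable def LineMap.unfoldLam (p : Boundary n × Boundary n) : Option V :=
  if φ.lam p = v then (if φ.dir p ∈ X ∨ φ.dir p.swap ∈ X then none else some v)
  else some (φ.lam p)

theorem LineMap.proj_unfoldLam (p : Boundary n × Boundary n) :
    proj v (φ.unfoldLam v X p) = φ.lam p := by
  unfold unfoldLam
  split_ifs with h1 h2
  · exact h1.symm
  · exact h1.symm
  · rfl

theorem LineMap.unfoldLam_swap {p : Boundary n × Boundary n} (hp : p ∈ lifts B)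
    (h : Pointed p) : φ.unfoldLam v X p.swap = φ.unfoldLam v X p := by
  unfold unfoldLam
  rw [φ.lam_swap p hp h, Prod.swap_swap]
  split_ifs <;> tauto

/-- A line that uses `X` on one side at `v` uses `X` or `x` on the other, so both of its directions
are attached to the new vertex `none`. -/
theorem LineMap.attached_dir
    (hturn : ∀ p ∈ lifts B, Pointed p → φ.lam p = v → φ.dir p ∈ X →
      φ.dir p.swap ∈ X ∨ φ.dir p.swap = x)
    {p : Boundary n × Boundary n} (hp : p ∈ lifts B) (h : Pointed p) :
    Attached v x X (φ.unfoldLam v X p) (φ.dir p) := by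
  unfold unfoldLam
  split_ifs with h1 h2
  · rcases h2 with h2 | h2
    · exact Or.inl h2
    · have := hturn p.swap (swap_mem_lifts hp) h.swap (by rw [φ.lam_swap p hp h, h1]) h2
      rwa [Prod.swap_swap] at this
  · exact fun _ h3 => h2 (Or.inl h3)
  · exact fun h3 => (h1 h3).elim

/-- The lifts of lines to the unfolded tree. -/
noncomputable def LineMap.unfold (hx : T.E x.1 v x.2) (hxX : x ∉ X)
    (hturn : ∀ p ∈ lifts B, Pointed p → φ.lam p = v → φ.dir p ∈ X →
      φ.dir p.swap ∈ X ∨ φ.dir p.swap = x) : LineMap (T.unfold v x X hx hxX) B where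
  lam := φ.unfoldLam v X
  lam_swap p hp h := φ.unfoldLam_swap hp h
  edge p hp h := by
    refine ⟨?_, ?_, ?_⟩
    · rw [φ.proj_unfoldLam, φ.proj_unfoldLam]
      exact φ.edge p hp h
    · rw [φ.proj_unfoldLam]
      exact φ.attached_dir hturn hp h
    · rw [φ.proj_unfoldLam, ← φ.dir_swap_step hp h, ← φ.unfoldLam_swap (step_mem_lifts hp) h.step]
      exact φ.attached_dir hturn (swap_mem_lifts (step_mem_lifts hp)) h.step.swap

theorem LineMap.unfold_visited
    (hturn : ∀ p ∈ lifts B, Pointed p → φ.lam p = v → φ.dir p ∈ X →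
      φ.dir p.swap ∈ X ∨ φ.dir p.swap = x)
    (hvis : ∀ u, ∃ p ∈ lifts B, Pointed p ∧ φ.lam p = u)
    (hX : ∃ d ∈ X, φ.Crosses B d.1 v d.2) (hY : ∃ d, d ∉ X ∧ d ≠ x ∧ φ.Crosses B d.1 v d.2)
    (a : Option V) : ∃ p ∈ lifts B, Pointed p ∧ φ.unfoldLam v X p = a := by
  cases a with
  | none =>
    obtain ⟨d, hd, p, hp, hpp, h1, h2⟩ := hX
    refine ⟨p, hp, hpp, ?_⟩
    rw [unfoldLam, if_pos h1, if_pos (Or.inl _)]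
    rw [h2]; exact hd
  | some u =>
    by_cases hu : u = v
    · subst hu
      obtain ⟨d, hd, hdx, p, hp, hpp, h1, h2⟩ := hY
      refine ⟨p, hp, hpp, ?_⟩
      rw [unfoldLam, if_pos h1, if_neg]
      have h3 : φ.dir p = d := h2
      rintro (h | h)
      · exact hd (h3 ▸ h)
      · have := hturn p.swap (swap_mem_lifts hp) hpp.swap (by rw [φ.lam_swap p hp hpp, h1]) h
        rw [Prod.swap_swap, h3] at this
        exact this.elim hd hdx
    · obtain ⟨p, hp, hpp, h1⟩ := hvis u
      refine ⟨p, hp, hpp, ?_⟩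
      rw [unfoldLam, if_neg (by rwa [h1]), h1]

/-! ### Counting the edges of an unfolding -/

/-- The oriented edges of the quotient graph. -/
abbrev LabelledTree.Dart (T : LabelledTree n V) : Type :=
  {q : V × Letter n × V // T.E q.2.1 q.1 q.2.2}

/-- Unfolding adds at most one edge. -/
theorem LabelledTree.card_dart_unfold_le [Finite V] (hx : T.E x.1 v x.2) (hxX : x ∉ X) :
    Nat.card (T.unfold v x X hx hxX).Dart ≤ Nat.card T.Dart + 2 := by
  classical
  -- The two values of `Bool` receive the orientations of the copy of `x` at `none`; all other darts
  -- inject into `T.Dart` by folding.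
  let f : (T.unfold v x X hx hxX).Dart → T.Dart ⊕ Bool := fun q =>
    if q.1.1 = none ∧ (q.1.2.1, proj v q.1.2.2) = x then Sum.inr true
    else if q.1.2.2 = none ∧ (q.1.2.1.inv, proj v q.1.1) = x then Sum.inr false
    else Sum.inl ⟨(proj v q.1.1, q.1.2.1, proj v q.1.2.2), q.2.1⟩
  have hinv : ∀ {t t' : Letter n}, t.inv = t'.inv → t = t' := fun {t t'} h => by
    rw [← Letter.inv_inv t, h, Letter.inv_inv]
  have hf : Function.Injective f := by
    rintro ⟨⟨a, t, b⟩, hE, hA, hB⟩ ⟨⟨a', t', b'⟩, hE', hA', hB'⟩ h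
    simp only [f] at h
    simp only at hE hA hB hE' hA' hB'
    refine Subtype.ext (show (a, t, b) = (a', t', b') from ?_)
    split_ifs at h with c1 c2 c3 c4 c5 c6
    · obtain ⟨rfl, c1⟩ := c1
      obtain ⟨rfl, c2⟩ := c2
      have ht : t = t' := (congrArg Prod.fst c1).trans (congrArg Prod.fst c2).symm
      subst ht
      have hb : b = b' := Attached.unique hB hB'
        ((congrArg Prod.snd c1).trans (congrArg Prod.snd c2).symm) fun _ h3 =>
          Letter.inv_ne t ((congrArg Prod.fst h3).trans (congrArg Prod.fst c1).symm)
      rw [hb]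
    · simp at h
    · simp at h
    · obtain ⟨rfl, k1⟩ := c4
      obtain ⟨rfl, k2⟩ := c6
      have ht : t = t' := hinv ((congrArg Prod.fst k1).trans (congrArg Prod.fst k2).symm)
      subst ht
      have ha : a = a' := Attached.unique hA hA'
        ((congrArg Prod.snd k1).trans (congrArg Prod.snd k2).symm) fun _ h3 =>
          Letter.inv_ne t ((congrArg Prod.fst k1).trans (congrArg Prod.fst h3).symm)
      rw [ha]
    · rw [Sum.inl.injEq, Subtype.mk.injEq, Prod.mk.injEq, Prod.mk.injEq] at h
      obtain ⟨h1, rfl, h2⟩ := h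
      have ha : a = a' := by
        by_cases hc : (t, proj v b) = x
        · cases a with
          | none => exact (c1 ⟨rfl, hc⟩).elim
          | some u =>
            cases a' with
            | none => rename_i d1 _; exact (d1 ⟨rfl, h2 ▸ hc⟩).elim
            | some u' => exact congrArg some h1
        · exact Attached.unique hA (h2 ▸ hA') h1 fun _ => hc
      have hb : b = b' := by
        by_cases hc : (t.inv, proj v a) = x
        · cases b with
          | none => exact (c4 ⟨rfl, hc⟩).elim
          | some u =>
            cases b' with
            | none => rename_i d1; exact (d1 ⟨rfl, h1 ▸ hc⟩).elim
            | some u' => exact congrArg some h2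
        · exact Attached.unique hB (h1 ▸ hB') h2 fun _ => hc
      rw [ha, hb]
  have := Nat.card_le_card_of_injective f hf
  rwa [Nat.card_sum, Nat.card_eq_fintype_card (α := Bool), Fintype.card_bool] at this

end Unfold

/-! ### The Cayley tree -/

/-- The Cayley tree. -/
def cayley (n : ℕ) : LabelledTree n Unit where
  E _ _ _ := True
  symm _ := trivial
  conn H hcl := by
    rintro ⟨⟨g, ⟨⟩⟩, hg⟩
    have key : ∀ y : FreeGroup (Fin n), (g * y, ()) ∈ H := fun y => by
      induction y using gen_induction with
      | h1 => simpa using hg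
      | hmul y s ih => exact hcl _ _ ⟨s, (mul_assoc _ _ _).symm, trivial⟩ ih
    rw [Set.eq_univ_iff_forall]
    rintro ⟨y, ⟨⟩⟩
    simpa using key (g⁻¹ * y)
  bridge := by
    rintro ⟨g, ⟨⟩⟩ ⟨_, ⟨⟩⟩ ⟨s, rfl, -⟩
    refine ⟨{y | (g⁻¹ * y.1).toWord.head? = some s}, ?_, ?_, ?_⟩
    · simp
    · simp [gen]
    · rintro ⟨y, ⟨⟩⟩ ⟨_, ⟨⟩⟩ ⟨t, rfl, -⟩ h1 h2
      simp only [Set.mem_ofPred_eq, ← mul_assoc] at h1 h2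
      rcases toWord_mul_gen (g⁻¹ * y) t with h3 | h3
      · rw [h3] at h2
        cases hw : (g⁻¹ * y).toWord with
        | nil =>
          rw [hw] at h2
          have hy : y = g := by
            rw [FreeGroup.toWord_eq_nil_iff, inv_mul_eq_one] at hw
            exact hw.symm
          have ht : t = s := by simpa using h2
          rw [hy, ht]
          exact ⟨rfl, rfl⟩
        | cons c l =>
          rw [hw] at h1 h2
          exact (h1 (by simpa using h2)).elim
      · refine (h1 ?_).elim
        rw [h3]
        cases hw : (g⁻¹ * y * gen t).toWord with
        | nil => rw [hw] at h2; simp at h2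
        | cons c l => rw [hw] at h2; simpa using h2

/-! ### Resolutions -/

/-- A finite graph unfolding the rose, to which the lines of `B` lift. -/
structure Resolution (n : ℕ) (B : Set (Line n)) where
  /-- The vertices. -/
  V : Type
  fin : Finite V
  /-- The tree over the Cayley tree. -/
  tree : LabelledTree n V
  /-- The lifts of the lines. -/
  map : LineMap tree B
  visited : ∀ v, ∃ p ∈ lifts B, Pointed p ∧ map.lam p = v
  -- With two darts per edge, this says that edges minus vertices is at most `n - 1`, a bound that
  -- unfolding preserves.
  card_le : Nat.card tree.Dart + 2 ≤ 2 * Nat.card V + 2 * n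

attribute [instance] Resolution.fin

/-- The trivial resolution. -/
theorem exists_resolution {B : Set (Line n)} (hB : B.Nonempty) :
    ∃ R : Resolution n B, Nat.card R.V = 1 := by
  refine ⟨⟨Unit, inferInstance, cayley n, ⟨fun _ => (), fun _ _ _ => rfl, fun _ _ _ => trivial⟩,
    fun v => ?_, ?_⟩, by simp⟩
  · obtain ⟨ℓ, hℓ⟩ := hB
    obtain ⟨p, hp, hpp, -⟩ := exists_pointed_mem_lifts hℓ
    exact ⟨p, hp, hpp, rfl⟩
  · have : Nat.card (cayley n).Dart ≤ Nat.card (Unit × Letter n × Unit) :=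
      Nat.card_le_card_of_injective _ Subtype.val_injective
    simp only [Nat.card_eq_fintype_card, Fintype.card_prod, Fintype.card_unit, Fintype.card_fin,
      Fintype.card_bool] at this ⊢
    omega

/-- `x` is not a cut direction at `v`: lines turn between any two complementary nonempty sets of
other directions. -/
def Resolution.NoCut {B : Set (Line n)} (R : Resolution n B) : Prop :=
  ∀ (v : R.V) (x : Letter n × R.V) (X : Set (Letter n × R.V)), R.tree.E x.1 v x.2 → x ∉ X →
    (∃ d ∈ X, R.tree.E d.1 v d.2) → (∃ d, d ∉ X ∧ d ≠ x ∧ R.tree.E d.1 v d.2) →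
    ∃ p ∈ lifts B, Pointed p ∧ R.map.lam p = v ∧ R.map.dir p ∈ X ∧ R.map.dir p.swap ∉ X ∧
      R.map.dir p.swap ≠ x

theorem Resolution.exists_succ {B : Set (Line n)} (R : Resolution n B)
    (hcross : ∀ s u w, R.tree.E s u w → R.map.Crosses B s u w) (h : ¬ R.NoCut) :
    ∃ R' : Resolution n B, Nat.card R'.V = Nat.card R.V + 1 := by
  unfold NoCut at h
  push Not at h
  obtain ⟨v, x, X, hx, hxX, ⟨d, hd, hdE⟩, ⟨d', hd', hdx', hdE'⟩, hno⟩ := h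
  have hturn : ∀ p ∈ lifts B, Pointed p → R.map.lam p = v → R.map.dir p ∈ X →
      R.map.dir p.swap ∈ X ∨ R.map.dir p.swap = x := fun p hp hpp h1 h2 => by
    by_contra! h3
    exact h3.2 (hno p hp hpp h1 h2 h3.1)
  have hcard : Nat.card (Option R.V) = Nat.card R.V + 1 := Finite.card_option
  refine ⟨⟨Option R.V, inferInstance, R.tree.unfold v x X hx hxX, R.map.unfold hx hxX hturn,
    R.map.unfold_visited hturn R.visited ⟨d, hd, hcross _ _ _ hdE⟩
      ⟨d', hd', hdx', hcross _ _ _ hdE'⟩, ?_⟩, hcard⟩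
  have h1 := R.tree.card_dart_unfold_le hx hxX
  have h2 := R.card_le
  rw [hcard]
  omega

end FreeLines

namespace FreeLines

open Filter Topology

variable {n : ℕ}

/-! ### Bounding the size of resolutions -/

/-- A bound for the number of vertices within distance `i` of a branch vertex. -/
def branchBound (n : ℕ) : ℕ → ℕ
  | 0 => 2 * n
  | i + 1 => 3 * branchBound n i + 2 * n

namespace Resolution

variable {B : Set (Line n)} (R : Resolution n B)

/-- The number of directions at a vertex. -/
noncomputable def deg (v : R.V) : ℕ := Nat.card {d : Letter n × R.V // R.tree.E d.1 v d.2}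

theorem two_le_deg (v : R.V) : 2 ≤ R.deg v := by
  obtain ⟨p, hp, hpp, rfl⟩ := R.visited v
  have : Nontrivial {d : Letter n × R.V // R.tree.E d.1 (R.map.lam p) d.2} :=
    ⟨⟨_, R.map.edge_dir hp hpp⟩, ⟨_, R.map.edge_dir_swap hp hpp⟩, fun h =>
      R.map.dir_swap_ne hpp (congrArg Subtype.val h)⟩
  exact Finite.one_lt_card

theorem eq_of_deg_eq_two {v : R.V} (h : R.deg v = 2) {a b c : Letter n × R.V}
    (ha : R.tree.E a.1 v a.2) (hb : R.tree.E b.1 v b.2) (hc : R.tree.E c.1 v c.2)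
    (hab : b ≠ a) (hac : c ≠ a) : b = c := by
  obtain ⟨y, -, hy⟩ := (Nat.card_eq_two_iff' (⟨a, ha⟩ : {d : Letter n × R.V //
    R.tree.E d.1 v d.2})).mp h
  have h1 := hy ⟨b, hb⟩ fun h => hab (congrArg Subtype.val h)
  have h2 := hy ⟨c, hc⟩ fun h => hac (congrArg Subtype.val h)
  exact congrArg Subtype.val (h1.trans h2.symm)

noncomputable instance : Fintype R.V := Fintype.ofFinite _

theorem sum_deg : ∑ v, R.deg v = Nat.card R.tree.Dart := by
  simp only [deg]
  rw [← Nat.card_sigma]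
  exact Nat.card_congr
    { toFun := fun q => ⟨(q.1, q.2.1), q.2.2⟩
      invFun := fun q => ⟨q.1.1, ⟨q.1.2, q.2⟩⟩
      left_inv := fun _ => rfl
      right_inv := fun _ => rfl }

/-- The vertices outside `S` use up at least two darts each of the total allowed by `card_le`. -/
theorem sum_deg_le (S : Finset R.V) : ∑ v ∈ S, R.deg v ≤ 2 * S.card + 2 * n := by
  classical
  have h1 := R.sum_deg
  have h2 := R.card_le
  rw [← Finset.sum_add_sum_compl S] at h1
  have h3 : 2 * Sᶜ.card ≤ ∑ v ∈ Sᶜ, R.deg v := by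
    rw [mul_comm, ← smul_eq_mul]
    exact Finset.card_nsmul_le_sum _ _ _ fun v _ => R.two_le_deg v
  have h4 := Finset.card_add_card_compl S
  rw [← Nat.card_eq_fintype_card] at h4
  omega

open Classical in
/-- The neighbours of a vertex in the quotient graph. -/
noncomputable def nbrs (v : R.V) : Finset R.V := {w | ∃ s, R.tree.E s v w}

theorem card_nbrs_le (v : R.V) : (R.nbrs v).card ≤ R.deg v := by
  have h : ∀ w : R.nbrs v, ∃ s, R.tree.E s v w := fun w => by
    have := w.2
    simpa [nbrs] using this
  choose f hf using h
  rw [← Fintype.card_coe, ← Nat.card_eq_fintype_card]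
  exact Nat.card_le_card_of_injective (fun w : R.nbrs v =>
    (⟨(f w, w.1), hf w⟩ : {d : Letter n × R.V // R.tree.E d.1 v d.2})) fun w w' h =>
      Subtype.ext (congrArg (fun d => d.1.2) h)

open Classical in
/-- The vertices within distance `i` of a branch vertex. -/
noncomputable def nearBranch : ℕ → Finset R.V
  | 0 => {v | R.deg v ≠ 2}
  | i + 1 => nearBranch i ∪ (nearBranch i).biUnion R.nbrs

/-- Branch vertices have degree at least three, so `3 * |S| ≤ 2 * |S| + 2 * n` for their set `S`.
Each further step adds at most the degree sum. -/
theorem card_nearBranch_le (i : ℕ) : (R.nearBranch i).card ≤ branchBound n i := by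
  classical
  induction i with
  | zero =>
    have h1 := R.sum_deg_le (R.nearBranch 0)
    have h2 : 3 * (R.nearBranch 0).card ≤ ∑ v ∈ R.nearBranch 0, R.deg v := by
      rw [mul_comm, ← smul_eq_mul]
      refine Finset.card_nsmul_le_sum _ _ _ fun v hv => ?_
      have h3 : R.deg v ≠ 2 := by simpa [nearBranch] using hv
      have := R.two_le_deg v
      omega
    rw [branchBound]
    omega
  | succ i ih =>
    have h1 := R.sum_deg_le (R.nearBranch i)
    have h2 : ((R.nearBranch i).biUnion R.nbrs).card ≤ ∑ v ∈ R.nearBranch i, R.deg v :=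
      Finset.card_biUnion_le.trans (Finset.sum_le_sum fun v _ => R.card_nbrs_le v)
    have h3 := Finset.card_union_le (R.nearBranch i) ((R.nearBranch i).biUnion R.nbrs)
    rw [nearBranch, branchBound]
    omega

theorem nearBranch_mono (i : ℕ) : R.nearBranch 0 ⊆ R.nearBranch i := by
  classical
  induction i with
  | zero => exact Finset.Subset.refl _
  | succ i ih => exact ih.trans Finset.subset_union_left

theorem deg_eq_two {i : ℕ} {v : R.V} (h : v ∉ R.nearBranch i) : R.deg v = 2 := by
  by_contra h1
  exact h (R.nearBranch_mono i (by simpa [nearBranch] using h1))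

theorem notMem_nearBranch_of_edge {i : ℕ} {v w : R.V} {s : Letter n}
    (h : v ∉ R.nearBranch (i + 1)) (hE : R.tree.E s v w) : w ∉ R.nearBranch i := by
  classical
  intro h1
  refine h (Finset.mem_union_right _ (Finset.mem_biUnion.mpr ⟨w, h1, ?_⟩))
  exact Finset.mem_filter.mpr ⟨Finset.mem_univ _, s.inv, R.tree.symm hE⟩

/-- At a vertex of degree two the exit is determined by the entry, so two lifts that start along the
same edge stay together until a branch vertex is reached. -/
theorem apply_eq_of_notMem_nearBranch {i : ℕ} {p p' : Boundary n × Boundary n}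
    (hp : p ∈ lifts B) (hpp : Pointed p) (hp' : p' ∈ lifts B) (hpp' : Pointed p')
    (hlam : R.map.lam p = R.map.lam p') (hdir : R.map.dir p = R.map.dir p')
    (h : R.map.lam p ∉ R.nearBranch i) : ∀ j ≤ i, p.1.1 j = p'.1.1 j := by
  induction i generalizing p p' with
  | zero =>
    intro j hj
    obtain rfl : j = 0 := by omega
    exact congrArg Prod.fst hdir
  | succ i ih =>
    intro j hj
    cases j with
    | zero => exact congrArg Prod.fst hdir
    | succ j =>
      have h0 : p.1.1 0 = p'.1.1 0 := congrArg Prod.fst hdir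
      have hlam' : R.map.lam (step p) = R.map.lam (step p') := congrArg Prod.snd hdir
      have hw := R.notMem_nearBranch_of_edge h (R.map.edge p hp hpp)
      have hs := step_mem_lifts hp
      have hs' := step_mem_lifts hp'
      have e1 : R.map.dir (step p).swap = R.map.dir (step p').swap := by
        rw [R.map.dir_swap_step hp hpp, R.map.dir_swap_step hp' hpp', h0, hlam]
      have hdir' : R.map.dir (step p) = R.map.dir (step p') := by
        refine R.eq_of_deg_eq_two (R.deg_eq_two hw) (a := R.map.dir (step p).swap)
          (R.map.edge_dir_swap hs hpp.step) (R.map.edge_dir hs hpp.step) ?_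
          (R.map.dir_swap_ne hpp.step) ?_
        · rw [hlam']
          exact R.map.edge_dir hs' hpp'.step
        · rw [e1]
          exact R.map.dir_swap_ne hpp'.step
      have := ih hs hpp.step hs' hpp'.step hlam' hdir' hw j (by omega)
      rwa [step_fst_apply, step_fst_apply] at this

theorem exists_agree {B₁ B₂ : Set (Line n)} (h₁ : B₁ ⊆ B) (h₂ : B₂ ⊆ B)
    (hc₁ : ∀ s u w, R.tree.E s u w → R.map.Crosses B₁ s u w)
    (hc₂ : ∀ s u w, R.tree.E s u w → R.map.Crosses B₂ s u w) {N : ℕ}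
    (hN : branchBound n N < Nat.card R.V) :
    ∃ p ∈ lifts B₁, ∃ p' ∈ lifts B₂, Pointed p ∧
      ∀ i ≤ N, p.1.1 i = p'.1.1 i ∧ p.2.1 i = p'.2.1 i := by
  obtain ⟨v, hv⟩ : ∃ v, v ∉ R.nearBranch N := by
    by_contra! h
    have h1 : R.nearBranch N = Finset.univ := Finset.eq_univ_iff_forall.mpr h
    have h2 := R.card_nearBranch_le N
    rw [h1, Finset.card_univ, ← Nat.card_eq_fintype_card] at h2
    omega
  obtain ⟨q, hq, hqp, hqv⟩ := R.visited v
  have hE := R.map.edge_dir hq hqp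
  rw [hqv] at hE
  obtain ⟨p, hp, hpp, hpv, -⟩ := hc₁ _ _ _ hE
  have hd := R.deg_eq_two hv
  have hpB := lifts_mono h₁ hp
  have key : ∃ p' ∈ lifts B₂, Pointed p' ∧ R.map.lam p' = v ∧ R.map.dir p = R.map.dir p' := by
    obtain ⟨p', hp', hpp', hpv', -⟩ := hc₂ _ _ _ hE
    have hpB' := lifts_mono h₂ hp'
    by_cases h : R.map.dir p = R.map.dir p'
    · exact ⟨p', hp', hpp', hpv', h⟩
    -- There are only two directions at `v`, so reversing the second line makes it leave like the
    -- first.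
    · refine ⟨p'.swap, swap_mem_lifts hp', hpp'.swap, ?_, ?_⟩
      · rw [R.map.lam_swap p' hpB' hpp', hpv']
      · subst hpv'
        refine R.eq_of_deg_eq_two hd (R.map.edge_dir hpB' hpp') ?_
          (R.map.edge_dir_swap hpB' hpp') h (R.map.dir_swap_ne hpp').symm
        rw [← hpv]
        exact R.map.edge_dir hpB hpp
  obtain ⟨p', hp', hpp', hpv', hdir⟩ := key
  have hpB' := lifts_mono h₂ hp'
  have hdir' : R.map.dir p.swap = R.map.dir p'.swap := by
    have e := R.map.edge_dir_swap hpB' hpp'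
    rw [hpv', ← hpv] at e
    refine R.eq_of_deg_eq_two (hpv ▸ hd) (R.map.edge_dir hpB hpp)
      (R.map.edge_dir_swap hpB hpp) e (R.map.dir_swap_ne hpp).symm ?_
    rw [hdir]
    exact (R.map.dir_swap_ne hpp').symm
  refine ⟨p, hp, p', hp', hpp, fun i hi => ⟨?_, ?_⟩⟩
  · exact R.apply_eq_of_notMem_nearBranch hpB hpp hpB' hpp' (hpv.trans hpv'.symm) hdir
      (hpv ▸ hv) i hi
  · refine R.apply_eq_of_notMem_nearBranch (swap_mem_lifts hpB) hpp.swap (swap_mem_lifts hpB')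
      hpp'.swap ?_ hdir' ?_ i hi
    · rw [R.map.lam_swap p hpB hpp, R.map.lam_swap p' hpB' hpp', hpv, hpv']
    · rw [R.map.lam_swap p hpB hpp, hpv]
      exact hv

end Resolution

/-! ### Limits of lines and termination of unfolding -/

theorem continuous_line_mk : Continuous (Line.mk : EndpointPair n → Line n) :=
  continuous_quot_mk

theorem tendsto_boundary_iff {ι : Type*} {l : Filter ι} {f : ι → Boundary n} {ξ : Boundary n} :
    Tendsto f l (𝓝 ξ) ↔ ∀ i, ∀ᶠ k in l, (f k).1 i = ξ.1 i := by
  rw [tendsto_subtype_rng, tendsto_pi_nhds]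
  refine forall_congr' fun i => ?_
  rw [nhds_discrete, tendsto_pure]

/-- Lines of `B₁` and `B₂` that agree on longer and longer segments accumulate on a common line. -/
theorem closure_inter_nonempty {B₁ B₂ : Set (Line n)}
    (h : ∀ N : ℕ, ∃ p ∈ lifts B₁, ∃ p' ∈ lifts B₂, Pointed p ∧
      ∀ i ≤ N, p.1.1 i = p'.1.1 i ∧ p.2.1 i = p'.2.1 i) :
    (closure B₁ ∩ closure B₂).Nonempty := by
  choose p hp p' hp' hpp hag using h
  have hfc : FirstCountableTopology (ℕ → Letter n) := inferInstance
  have hfc' : FirstCountableTopology (Boundary n) :=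
    Topology.IsInducing.subtypeVal.firstCountableTopology
  obtain ⟨q, φ, hφ, hq⟩ := CompactSpace.tendsto_subseq p
  rw [Prod.tendsto_iff] at hq
  have hq1 := tendsto_boundary_iff.mp hq.1
  have hq2 := tendsto_boundary_iff.mp hq.2
  have hev : ∀ i, ∀ᶠ k in atTop, i ≤ φ k := fun i => hφ.tendsto_atTop.eventually_ge_atTop i
  have hq1' : ∀ i, ∀ᶠ k in atTop, (p' (φ k)).1.1 i = q.1.1 i := fun i => by
    filter_upwards [hq1 i, hev i] with k h1 h2
    rw [← (hag _ i h2).1]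
    exact h1
  have hq2' : ∀ i, ∀ᶠ k in atTop, (p' (φ k)).2.1 i = q.2.1 i := fun i => by
    filter_upwards [hq2 i, hev i] with k h1 h2
    rw [← (hag _ i h2).2]
    exact h1
  -- Being pointed depends on the first letters only, so it passes to the limit and keeps the
  -- endpoints distinct.
  have hne : q.1 ≠ q.2 := by
    obtain ⟨k, h1, h2⟩ := ((hq1 0).and (hq2 0)).exists
    intro h3
    apply hpp (φ k)
    change (p (φ k)).1.1 0 = q.1.1 0 at h1
    change (p (φ k)).2.1 0 = q.2.1 0 at h2
    rw [h1, h2, h3]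
  have key : ∀ (B : Set (Line n)) (r : ℕ → Boundary n × Boundary n), (∀ k, r k ∈ lifts B) →
      Tendsto r atTop (𝓝 q) → Line.mk ⟨q, hne⟩ ∈ closure B := by
    intro B r hr ht
    have h1 : Tendsto (fun k => (⟨r k, (hr k).1⟩ : EndpointPair n)) atTop (𝓝 ⟨q, hne⟩) :=
      tendsto_subtype_rng.mpr ht
    exact mem_closure_of_tendsto ((continuous_line_mk.tendsto _).comp h1)
      (Eventually.of_forall fun k => (hr k).2)
  refine ⟨Line.mk ⟨q, hne⟩, key B₁ (p ∘ φ) (fun k => hp _) ?_, key B₂ (p' ∘ φ) (fun k => hp' _) ?_⟩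
  · exact (Prod.tendsto_iff _ _).mpr hq
  · exact (Prod.tendsto_iff _ _).mpr
      ⟨tendsto_boundary_iff.mpr hq1', tendsto_boundary_iff.mpr hq2'⟩

/-- The empty free factor system carries every line of the empty set, and it does not contain
`[F_n]`. -/
theorem IsFilling.nonempty {B : Set (Line n)} (h : IsFilling B) : B.Nonempty := by
  by_contra h0
  rw [Set.not_nonempty_iff_eq_empty] at h0
  subst h0
  have hFF : IsFreeFactorSystem (∅ : Set (SubgroupClass (FreeGroup (Fin n)))) := by
    refine ⟨⟨Set.finite_empty, fun A hA => hA.elim⟩, 0, ![], ⊤, by simp, ?_⟩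
    have hC : IsFreeFactorization (⊤ : Subgroup (FreeGroup (Fin n)))
        (fun _ : Fin 1 => (⊤ : Subgroup (FreeGroup (Fin n)))) := by
      constructor
      · let χ := (Monoid.CoprodI.of (M := fun _ : Fin 1 =>
          (⊤ : Subgroup (FreeGroup (Fin n)))) (i := 0)).comp Subgroup.topEquiv.symm.toMonoidHom
        have hχ : χ.comp (Monoid.CoprodI.lift fun _ : Fin 1 =>
            (⊤ : Subgroup (FreeGroup (Fin n))).subtype) = MonoidHom.id _ := by
          refine Monoid.CoprodI.ext_hom _ _ fun i => ?_
          obtain rfl := Subsingleton.elim i 0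
          ext x
          simp only [χ, MonoidHom.comp_apply, Monoid.CoprodI.lift_of]
          rfl
        exact Function.LeftInverse.injective (g := χ) (DFunLike.congr_fun hχ)
      · rw [MonoidHom.range_eq_top]
        exact fun g => ⟨Monoid.CoprodI.of (i := 0) ⟨g, Subgroup.mem_top g⟩, by simp⟩
    convert hC using 1
    funext i
    fin_cases i
    rfl
  exact exists_conjClass_top_of_isFilling h hFF fun ℓ hℓ => hℓ.elim

/-- Filling sets of lines with disjoint closures have a resolution without cut directions. -/
theorem exists_noCut (hn : 2 ≤ n) {B₁ B₂ : Set (Line n)} (hB₁ : IsFilling B₁)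
    (hB₂ : IsFilling B₂) (hdisj : closure B₁ ∩ closure B₂ = ∅) :
    ∃ R : Resolution n (B₁ ∪ B₂), R.NoCut := by
  have hc : ∀ (R : Resolution n (B₁ ∪ B₂)) (B' : Set (Line n)), B' ⊆ B₁ ∪ B₂ → IsFilling B' →
      ∀ s u w, R.tree.E s u w → R.map.Crosses B' s u w := fun R B' h1 h2 s u w hE =>
    R.map.crosses_of_isFilling hn R.visited h1 h2 hE
  have hc' : ∀ (R : Resolution n (B₁ ∪ B₂)), ∀ s u w, R.tree.E s u w →
      R.map.Crosses (B₁ ∪ B₂) s u w := fun R s u w hE => by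
    obtain ⟨p, hp, h⟩ := hc R B₁ Set.subset_union_left hB₁ s u w hE
    exact ⟨p, lifts_mono Set.subset_union_left hp, h⟩
  by_contra! hno
  have hall : ∀ k : ℕ, ∃ R : Resolution n (B₁ ∪ B₂), Nat.card R.V = k + 1 := by
    intro k
    induction k with
    | zero => exact exists_resolution (hB₁.nonempty.mono Set.subset_union_left)
    | succ k ih =>
      obtain ⟨R, hR⟩ := ih
      obtain ⟨R', hR'⟩ := R.exists_succ (hc' R) (hno R)
      exact ⟨R', by rw [hR', hR]⟩
  have := closure_inter_nonempty (B₁ := B₁) (B₂ := B₂) fun N => by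
    obtain ⟨R, hR⟩ := hall (branchBound n N)
    exact R.exists_agree Set.subset_union_left Set.subset_union_right
      (hc R B₁ Set.subset_union_left hB₁) (hc R B₂ Set.subset_union_right hB₂) (by omega)
  rw [hdisj] at this
  exact Set.not_nonempty_empty this

end FreeLines

namespace FreeLines

open Filter Topology
open scoped Pointwise

/-! ### The cut of the boundary given by a free factor -/

section Cocycle

variable {G : Type*} [Group G]

open Classical in
/-- A free factorization `G = A * C` gives a function on `G`, invariant under right multiplication
by `A`, that changes along right multiplication by elements of `C` only at `1`. -/
theorem exists_cocycle {A C : Subgroup G} (h : IsFreeFactorization ⊤ ![A, C]) :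
    ∃ f : G → ZMod 2, f 1 = 0 ∧ (∀ g, ∀ a ∈ A, f (g * a) = f g) ∧
      ∀ g, ∀ c ∈ C, f (g * c) = f g + ((if g = 1 then 1 else 0) + if g * c = 1 then 1 else 0) := by
  let δ : G → ZMod 2 := fun g => if g = 1 then 1 else 0
  have hδ : ∀ g, δ g + δ g = 0 := fun g => CharTwo.add_self_eq_zero _
  let P : G →* Equiv.Perm (G × ZMod 2) :=
    { toFun := fun g => (Equiv.mulLeft g).prodCongr (Equiv.refl _)
      map_one' := by ext x <;> simp
      map_mul' := fun a b => by ext x <;> simp [mul_assoc] }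
  have hinv : Function.Involutive fun x : G × ZMod 2 => (x.1, x.2 + δ x.1) := fun x => by
    simp [add_assoc, hδ]
  let Q : Equiv.Perm (G × ZMod 2) := hinv.toPerm
  have hQ : ∀ x, Q x = (x.1, x.2 + δ x.1) := fun _ => rfl
  have hQ' : ∀ x, Q⁻¹ x = (x.1, x.2 + δ x.1) := fun _ => rfl
  -- `A` acts by translation and `C` by translation conjugated with the flip `Q` over `1`; freeness
  -- combines them into an action of `G`. The resulting `f g` is the parity with which the path from
  -- `A` to `gA` in the Bass-Serre tree crosses the base edge.
  let ψ : ∀ i, (![A, C] : Fin 2 → Subgroup G) i →* Equiv.Perm (G × ZMod 2) := fun i =>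
    (if i = 0 then P else (MulAut.conj Q).toMonoidHom.comp P).comp (![A, C] i).subtype
  have hb : Function.Bijective (Monoid.CoprodI.lift fun i =>
      ((![A, C] : Fin 2 → Subgroup G) i).subtype) := ⟨h.1, MonoidHom.range_eq_top.mp h.2⟩
  let e := MulEquiv.ofBijective _ hb
  let θ : G →* Equiv.Perm (G × ZMod 2) :=
    (Monoid.CoprodI.lift ψ).comp e.symm.toMonoidHom
  have hθ : ∀ (i : Fin 2) (a : (![A, C] : Fin 2 → Subgroup G) i), θ a.1 = ψ i a := fun i a => by
    have h1 : e (Monoid.CoprodI.of a) = a.1 := Monoid.CoprodI.lift_of _ _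
    change Monoid.CoprodI.lift ψ (e.symm a.1) = _
    rw [← h1, MulEquiv.symm_apply_apply, Monoid.CoprodI.lift_of]
  have hθA : ∀ a ∈ A, ∀ x, θ a x = (a * x.1, x.2) := fun a ha x => by
    rw [hθ 0 ⟨a, ha⟩]; rfl
  have hθC : ∀ c ∈ C, ∀ x, θ c x = (c * x.1, x.2 + δ x.1 + δ (c * x.1)) := fun c hc x => by
    rw [hθ 1 ⟨c, hc⟩]; rfl
  have hfst : ∀ g x, (θ g x).1 = g * x.1 := by
    intro g
    obtain ⟨m, rfl⟩ := hb.2 g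
    induction m using Monoid.CoprodI.induction_on with
    | one => simp
    | of i a =>
      intro x
      rw [Monoid.CoprodI.lift_of]
      fin_cases i
      · exact congrArg Prod.fst (hθA a.1 a.2 x)
      · exact congrArg Prod.fst (hθC a.1 a.2 x)
    | mul a b ha hb => intro x; rw [map_mul, map_mul, Equiv.Perm.mul_apply, ha, hb, mul_assoc]
  refine ⟨fun g => (θ g⁻¹ (1, 0)).2, by simp, fun g a ha => ?_, fun g c hc => ?_⟩
  · simp only [mul_inv_rev, map_mul, Equiv.Perm.mul_apply]
    rw [hθA _ (A.inv_mem ha)]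
  · simp only [mul_inv_rev, map_mul, Equiv.Perm.mul_apply]
    rw [hθC _ (C.inv_mem hc), hfst]
    simp only [δ, mul_one, ← mul_inv_rev, inv_eq_one, add_assoc]

theorem IsFreeFactorization.induction {ι : Type*} {A : ι → Subgroup G}
    (h : IsFreeFactorization ⊤ A) {p : G → Prop} (h1 : p 1) (hA : ∀ i, ∀ a ∈ A i, p a)
    (hmul : ∀ a b, p a → p b → p (a * b)) (g : G) : p g := by
  obtain ⟨m, rfl⟩ := MonoidHom.range_eq_top.mp h.2 g
  induction m using Monoid.CoprodI.induction_on with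
  | one => rwa [map_one]
  | of i a => rw [Monoid.CoprodI.lift_of]; exact hA i a a.2
  | mul a b ha hb => rw [map_mul]; exact hmul _ _ ha hb

/-- A proper free factor is cut off by an almost invariant function. -/
theorem exists_almostInvariant {A C : Subgroup G} (h : IsFreeFactorization ⊤ ![A, C]) :
    ∃ f : G → ZMod 2, (∀ g, ∀ a ∈ A, f (g * a) = f g) ∧ (∀ y, {g | f (g * y) ≠ f g}.Finite) ∧
      (∀ a ∈ A, f a = 0) ∧ ∀ c ∈ C, c ≠ 1 → f c = 1 := by
  obtain ⟨f, h1, hA, hC⟩ := exists_cocycle h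
  refine ⟨f, hA, ?_, fun a ha => ?_, fun c hc hc1 => ?_⟩
  · intro y
    induction y using h.induction with
    | h1 => simp
    | hA i a ha =>
      fin_cases i
      · have : {g | f (g * a) ≠ f g} = ∅ := by
          ext g
          simpa using hA g a ha
        rw [this]
        exact Set.finite_empty
      · refine (Set.toFinite {1, a⁻¹}).subset fun g hg => ?_
        by_contra hg'
        simp only [Set.mem_insert_iff, Set.mem_singleton_iff, not_or] at hg'
        refine hg ?_
        rw [hC g a ha, if_neg hg'.1, if_neg fun h => hg'.2 (eq_inv_of_mul_eq_one_left h)]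
        simp
    | hmul a b ha hb =>
      refine (ha.union (hb.preimage (f := fun g => g * a)
        (mul_left_injective a).injOn)).subset fun g hg => ?_
      by_contra hg'
      simp only [Set.mem_union, Set.mem_ofPred_eq, Set.mem_preimage, not_or, not_not] at hg'
      exact hg (by rw [← mul_assoc, hg'.2, hg'.1])
  · simpa [h1] using hA 1 a ha
  · simpa [h1, hc1] using hC 1 c hc

end Cocycle

variable {n : ℕ} {V : Type}

/-! ### Ends of almost invariant sets -/

theorem almostInvariant_of_fun {f : FreeGroup (Fin n) → ZMod 2}
    (hf : ∀ y, {g | f (g * y) ≠ f g}.Finite) :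
    AlmostInvariant ({z | f z.1 = 1} : Set (Vert n V)) := by
  intro y y'
  refine ((hf y.1).union (hf y'.1)).subset fun g hg => ?_
  by_contra hg'
  simp only [Set.mem_union, Set.mem_ofPred_eq, not_or, not_not] at hg'
  apply hg
  simp only [tr, Set.mem_ofPred_eq]
  rw [hg'.1, hg'.2]

theorem AlmostInvariant.tr {H : Set (Vert n V)} (h : AlmostInvariant H)
    (a : FreeGroup (Fin n)) : AlmostInvariant {z | tr a z ∈ H} := by
  intro y y'
  refine ((h y y').preimage (f := fun g => a * g) (mul_right_injective a).injOn).subset ?_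
  intro g hg
  simpa [tr_tr] using hg

theorem endsIn_smul_iff {H : Set (Vert n V)} {ξ : Boundary n} (g : FreeGroup (Fin n)) :
    EndsIn H (g • ξ) ↔ EndsIn {z | tr g z ∈ H} ξ := by
  constructor
  · intro h
    have := h.smul g⁻¹
    rwa [inv_smul_smul, inv_inv] at this
  · intro h
    have := h.smul g
    simpa [Set.mem_ofPred_eq] using this

/-- The geodesic from `pre ξ m` to `a` runs outside the ball of radius `N`, where membership in `H`
does not change. -/
theorem StableFrom.mem_iff_of_isPrefix {H : Set (Vert n V)} {N m : ℕ} (h : StableFrom H N)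
    {ξ : Boundary n} {a : FreeGroup (Fin n)} (hm : N ≤ m)
    (ha : (List.ofFn fun i : Fin m => ξ.1 i) <+: a.toWord) (u : V) :
    (pre ξ m, u) ∈ H ↔ (a, u) ∈ H := by
  obtain ⟨L, hL⟩ := ha
  have key : ∀ L : List (Letter n),
      FreeGroup.IsReduced ((List.ofFn fun i : Fin m => ξ.1 i) ++ L) →
      ((pre ξ m, u) ∈ H ↔
        (FreeGroup.mk ((List.ofFn fun i : Fin m => ξ.1 i) ++ L), u) ∈ H) := by
    intro L
    induction L using List.reverseRecOn with
    | nil => intro _; rw [List.append_nil]; rfl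
    | append_singleton L s ih =>
      intro hr
      have hr' : FreeGroup.IsReduced ((List.ofFn fun i : Fin m => ξ.1 i) ++ L) := by
        rw [← List.append_assoc] at hr
        exact List.IsChain.left_of_append hr
      rw [ih hr', ← List.append_assoc, ← FreeGroup.mul_mk (L₂ := [s])]
      refine (h _ ?_ u u).2 s
      rw [FreeGroup.norm, FreeGroup.toWord_mk, hr'.reduce_eq]
      simp
      omega
  have hr : FreeGroup.IsReduced ((List.ofFn fun i : Fin m => ξ.1 i) ++ L) :=
    hL ▸ FreeGroup.isReduced_toWord
  rw [key L hr, hL, FreeGroup.mk_toWord]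

/-- The lines carried by a free factor are not cut by its almost invariant function. -/
theorem endsIn_of_mem_boundaryOf [Finite V] [Nonempty V] {f : FreeGroup (Fin n) → ZMod 2}
    (hf : ∀ y, {g | f (g * y) ≠ f g}.Finite) {A : Subgroup (FreeGroup (Fin n))}
    (hA : ∀ g, ∀ a ∈ A, f (g * a) = f g) (c : ConjAct (FreeGroup (Fin n))) {ξ : Boundary n}
    (hξ : ξ ∈ boundaryOf (c • A)) (g : FreeGroup (Fin n)) :
    EndsIn ({z | f z.1 = 1} : Set (Vert n V)) (g • ξ) ↔ f (g * ConjAct.ofConjAct c) = 1 := by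
  obtain ⟨u⟩ := ‹Nonempty V›
  set c' := ConjAct.ofConjAct c with hc'
  rw [endsIn_smul_iff]
  obtain ⟨N, hN⟩ := ((almostInvariant_of_fun (V := V) hf).tr g).exists_stableFrom
  have hfin : {a | f (g * a * c' * c'⁻¹) ≠ f (g * a * c')}.Finite := by
    refine ((hf c'⁻¹).preimage (f := fun a => g * a * c') fun a _ b _ hab => ?_)
    simpa using hab
  obtain ⟨M, hM⟩ := (hfin.image FreeGroup.norm).bddAbove
  -- Length `N` reaches the stable range; `M + 1` more letters place `a` outside the finite set
  -- where right multiplication by `c'⁻¹` changes `f`.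
  obtain ⟨a, ha, hpre⟩ := hξ (N + (M + 1))
  rw [hN.endsIn_iff ξ u (M + 1), hN.mem_iff_of_isPrefix (by omega) hpre u]
  have hnorm : M < a.norm := by
    have := hpre.length_le
    rw [List.length_ofFn] at this
    rw [FreeGroup.norm]
    omega
  have h1 : f (g * a * c' * c'⁻¹) = f (g * a * c') := by
    by_contra h2
    have := hM ⟨a, h2, rfl⟩
    omega
  obtain ⟨b, hb, hba⟩ := ha
  have hba' : a = c' * b * c'⁻¹ := hba.symm.trans (ConjAct.smul_def c b)
  have h2 : g * a * c' = g * c' * b := by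
    rw [hba']
    group
  have h3 : f (g * a) = f (g * c') := by
    rw [mul_inv_cancel_right] at h1
    rw [h1, h2, hA _ b hb]
  change f (g * a) = 1 ↔ _
  rw [h3]

/-- The last letter of `g` is repeated forever; the word stays reduced because no letter is its own
inverse. -/
theorem exists_pre_eq {g : FreeGroup (Fin n)} (hg : g ≠ 1) : ∃ ξ : Boundary n, pre ξ g.norm = g := by
  have hne : g.toWord ≠ [] := fun h => hg (FreeGroup.toWord_eq_nil_iff.mp h)
  set L := g.toWord with hL
  have hred : FreeGroup.IsReduced L := FreeGroup.isReduced_toWord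
  rw [FreeGroup.IsReduced, List.isChain_iff_getElem] at hred
  set t := L.getLast hne with ht
  have hlt : ∀ i (hi : i < L.length), L.getD i t = L[i] := fun i hi => by simp [hi]
  have hge : ∀ i, L.length ≤ i + 1 → L.getD i t = t := by
    intro i hi
    by_cases h : i < L.length
    · rw [hlt i h, ht, List.getLast_eq_getElem]
      congr 1
      omega
    · simp [not_lt.mp h]
  refine ⟨⟨fun i => L.getD i t, fun i => ?_⟩, ?_⟩
  · by_cases hi : i + 1 < L.length
    · have h1 := hred i hi
      simp only
      rw [hlt _ hi, hlt i (by omega)]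
      intro h2
      have h3 := h1 (by rw [h2]; rfl)
      rw [h2] at h3
      simp [Letter.inv] at h3
    · simp only
      rw [hge _ (by omega), hge _ (by omega)]
      exact (Letter.inv_ne t).symm
  · have h1 : (List.ofFn fun i : Fin g.norm => L.getD i t) = L := by
      refine List.ext_getElem (by simp [FreeGroup.norm, hL]) fun i h1 h2 => ?_
      rw [List.getElem_ofFn]
      exact hlt i h2
    change FreeGroup.mk (List.ofFn fun i : Fin g.norm => L.getD i t) = g
    rw [h1, FreeGroup.mk_toWord]

theorem finite_norm_lt (N : ℕ) : {g : FreeGroup (Fin n) | g.norm < N}.Finite := by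
  refine Set.Finite.of_finite_image (f := FreeGroup.toWord) ?_ FreeGroup.toWord_injective.injOn
  refine (List.finite_length_lt (Letter n) N).subset ?_
  rintro _ ⟨g, hg, rfl⟩
  exact hg

theorem exists_endsIn [Finite V] [Nonempty V] {H : Set (Vert n V)} (h : AlmostInvariant H)
    {S : Set (FreeGroup (Fin n))} (hS : S.Infinite) (hSH : ∀ g ∈ S, ∀ u, (g, u) ∈ H) :
    ∃ ξ, EndsIn H ξ := by
  obtain ⟨N, hN⟩ := h.exists_stableFrom
  obtain ⟨u⟩ := ‹Nonempty V›
  obtain ⟨g, hg, hgN⟩ := hS.exists_notMem_finite (finite_norm_lt (N + 1))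
  simp only [Set.mem_ofPred_eq, not_lt] at hgN
  obtain ⟨ξ, hξ⟩ := exists_pre_eq (g := g) (fun h1 => by rw [h1, FreeGroup.norm_one] at hgN; omega)
  obtain ⟨k, hk⟩ := Nat.exists_eq_add_of_le (show N ≤ g.norm by omega)
  refine ⟨ξ, (hN.endsIn_iff ξ u k).mpr ?_⟩
  rw [← hk, hξ]
  exact hSH g hg u

end FreeLines

namespace FreeLines

open Filter Topology
open scoped Pointwise

variable {n : ℕ} {V : Type}

/-! ### Half spaces at a vertex -/

/-- The neighbour of a vertex in a direction. -/
def nbrAt (z : Vert n V) (d : Letter n × V) : Vert n V := (z.1 * gen d.1, d.2)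

namespace LabelledTree

variable {T : LabelledTree n V} {z z' : Vert n V}

theorem half_disjoint {r r' : Vert n V} (h : T.Adj z r) (h' : T.Adj z r') (hne : r ≠ r') :
    Disjoint (T.half z r) (T.half z r') :=
  isHalf_disjoint h h' (isHalf_half h) (isHalf_half h') (isHalf_half h').1 (isHalf_half h).1
    fun e => hne (congrArg Prod.snd e)

theorem half_subset (h : T.Adj z z') {r : Vert n V} (hr : T.Adj z' r) (hne : r ≠ z) :
    T.half z' r ⊆ T.half z z' := by
  have := half_disjoint hr (Adj.symm h) hne
  rw [half_symm h] at this
  exact Set.disjoint_compl_right_iff_subset.mp this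

theorem exists_mem_half (h : T.Adj z z') {y : Vert n V} (hy : y ∈ T.half z z') (hne : y ≠ z') :
    ∃ r, T.Adj z' r ∧ r ≠ z ∧ y ∈ T.half z' r := by
  have hH := isHalf_half h
  have key : {y | y ∈ T.half z z' ∧ y ≠ z' ∧ ∀ r, T.Adj z' r → r ≠ z → y ∉ T.half z' r} = ∅ := by
    refine eq_empty_of_closed (T := T) (y := z) ?_ fun h1 => hH.1 h1.1
    rintro y y' hyy' ⟨h1, h2, h3⟩
    refine ⟨?_, ?_, ?_⟩
    · by_contra h4
      exact h2 (hH.2.2 _ _ (Adj.symm hyy') h4 h1).2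
    · rintro rfl
      exact h3 y (Adj.symm hyy') (fun h5 => hH.1 (h5 ▸ h1)) (isHalf_half (Adj.symm hyy')).2.1
    · intro r hr hrz h4
      exact h2 ((isHalf_half hr).2.2 _ _ hyy' (h3 r hr hrz) h4).1
  by_contra! hc
  have : y ∈ (∅ : Set (Vert n V)) := key ▸ ⟨hy, hne, fun r h1 h2 => hc r h1 h2⟩
  exact this

theorem adj_nbrAt {d : Letter n × V} (h : T.E d.1 z.2 d.2) : T.Adj z (nbrAt z d) := ⟨d.1, rfl, h⟩

theorem nbrAt_injective (z : Vert n V) : Function.Injective (nbrAt z) := by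
  intro d d' h
  exact Prod.ext (gen_injective (mul_left_cancel (congrArg Prod.fst h)))
    (congrArg (fun y : Vert n V => y.2) h)

theorem exists_nbrAt (h : T.Adj z z') : ∃ d, T.E d.1 z.2 d.2 ∧ z' = nbrAt z d := by
  obtain ⟨s, h1, h2⟩ := h
  exact ⟨(s, z'.2), h2, Prod.ext h1 rfl⟩

theorem half_nbrAt {d : Letter n × V} (h : T.E d.1 z.2 d.2) :
    T.half z (nbrAt z d) = {y | tr z.1⁻¹ y ∈ T.half (1, z.2) (nbr d)} := by
  have h1 := half_tr (adj_nbr h) z.1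
  have e1 : tr z.1 (1, z.2) = z := by simp [tr]
  rwa [e1] at h1

/-- There are finitely many directions at `z'`. A ray that left all the half spaces beyond them
while staying beyond `z z'` could only be at `z'`, but it eventually leaves every fibre. -/
theorem endsIn_half_step [Finite V] [Nonempty V] (h : T.Adj z z') {ξ : Boundary n}
    (hξ : EndsIn (T.half z z') ξ) :
    ∃ d, T.E d.1 z'.2 d.2 ∧ nbrAt z' d ≠ z ∧ EndsIn (T.half z' (nbrAt z' d)) ξ := by
  by_contra! hc
  have h1 : ∀ d : Letter n × V, ∀ᶠ i in atTop, T.E d.1 z'.2 d.2 → nbrAt z' d ≠ z →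
      ∀ u, (pre ξ i, u) ∉ T.half z' (nbrAt z' d) := by
    intro d
    by_cases hd : T.E d.1 z'.2 d.2 ∧ nbrAt z' d ≠ z
    · have h2 := hc d hd.1 hd.2
      rw [← (almostInvariant (isHalf_half (adj_nbrAt hd.1))).endsIn_compl] at h2
      filter_upwards [h2] with i hi _ _
      exact hi
    · exact Eventually.of_forall fun i h3 h4 => (hd ⟨h3, h4⟩).elim
  obtain ⟨u⟩ := ‹Nonempty V›
  obtain ⟨i, hi1, hi2, hi3⟩ := ((eventually_all.mpr h1).and
    (hξ.and (eventually_gt_atTop z'.1.norm))).exists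
  have hne : (pre ξ i, u) ≠ z' := fun h4 => by
    have := norm_pre ξ i
    rw [← h4] at hi3
    simp only [this, lt_self_iff_false] at hi3
  obtain ⟨r, hr, hrz, hm⟩ := exists_mem_half h (hi2 u) hne
  obtain ⟨d, hd, rfl⟩ := exists_nbrAt hr
  exact hi1 d hd hrz u hm

/-- Only finitely many edges cross an almost invariant set. -/
theorem finite_changed [Finite V] (T : LabelledTree n V) {P : Set (Vert n V)}
    (hP : AlmostInvariant P) : {z | ∃ z', T.Adj z z' ∧ ¬ (z ∈ P ↔ z' ∈ P)}.Finite := by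
  have : (⋃ q : V × Letter n × V, (fun g => tr g ((1, q.1) : Vert n V)) ''
      {g | ¬ (tr g ((1, q.1) : Vert n V) ∈ P ↔ tr g (nbr q.2) ∈ P)}).Finite :=
    Set.finite_iUnion fun q => (hP _ _).image _
  refine this.subset ?_
  rintro ⟨g, u⟩ ⟨⟨g', w⟩, ⟨s, h1, -⟩, h2⟩
  refine Set.mem_iUnion.mpr ⟨(u, s, w), g, ?_, by simp [tr]⟩
  have h1' : g' = g * gen s := h1
  simpa [tr, nbr, ← h1'] using h2

end LabelledTree

/-! ### Resolutions without cut directions -/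

/-- If a resolution has no cut directions, then a clopen set of ends that does not cut lines
realizing the turns of the resolution is trivial. -/
theorem Resolution.NoCut.endsIn_iff {B : Set (Line n)} {R : Resolution n B} (hR : R.NoCut)
    [Nonempty R.V]
    {P : Set (Vert n R.V)} (hP : AlmostInvariant P)
    (hline : ∀ p ∈ lifts B, Pointed p → ∃ q : Boundary n × Boundary n,
      (∀ g : FreeGroup (Fin n), EndsIn P (g • q.1) ↔ EndsIn P (g • q.2)) ∧
      EndsIn (R.tree.half (1, R.map.lam p) (nbr (R.map.dir p))) q.1 ∧
      EndsIn (R.tree.half (1, R.map.lam p) (nbr (R.map.dir p.swap))) q.2)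
    (ξ ξ' : Boundary n) : EndsIn P ξ ↔ EndsIn P ξ' := by
  set T := R.tree with hT
  obtain ⟨v₀⟩ := ‹Nonempty R.V›
  obtain ⟨p₀, hp₀, hpp₀, hv₀⟩ := R.visited v₀
  have hE₀ := R.map.edge_dir hp₀ hpp₀
  set z₀ : Vert n R.V := (1, R.map.lam p₀) with hz₀
  set z₁ : Vert n R.V := nbr (R.map.dir p₀) with hz₁
  have hadj : T.Adj z₀ z₁ := adj_nbr hE₀
  -- A finite subtree that contains every edge along which `P` changes.
  obtain ⟨A, hAfin, hz₀A, hSA, hconn⟩ := T.exists_finite_connected z₀ _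
    ((T.finite_changed hP).insert z₁)
  have hz₁A : z₁ ∈ A := hSA (Set.mem_insert _ _)
  have hchA : ∀ z z', T.Adj z z' → z ∉ A → (z ∈ P ↔ z' ∈ P) := fun z z' h1 h2 => by
    by_contra h3
    exact h2 (hSA (Set.mem_insert_of_mem _ ⟨z', h1, h3⟩))
  have hstep : ∀ z z', T.Adj z z' → z ∈ A → (∃ a ∈ A, a ∈ T.half z z') → z' ∈ A := by
    intro z z' h1 hzA h2
    have hH := LabelledTree.isHalf_half h1
    by_cases h3 : z₀ ∈ T.half z z'
    · obtain ⟨a, ha, b, hb, hab, h4, h5⟩ := hconn (T.half z z')ᶜ (fun h => h h3) ⟨z, hzA, hH.1⟩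
      rw [← (hH.2.2 _ _ (LabelledTree.Adj.symm hab) h5 (not_not.mp h4)).2]
      exact ha
    · obtain ⟨a, ha, b, hb, hab, h4, h5⟩ := hconn (T.half z z') h3 h2
      rw [← (hH.2.2 _ _ hab h4 h5).2]
      exact hb
  -- Ends beyond an edge that starts in `A` all agree about `P`, by induction on how much of `A`
  -- lies beyond it. If nothing of `A` does, `P` is constant there.
  have hmono : ∀ k : ℕ, ∀ z z', T.Adj z z' → z ∈ A → (A ∩ T.half z z').ncard ≤ k →
      ∀ ξ ξ', EndsIn (T.half z z') ξ → EndsIn (T.half z z') ξ' → EndsIn P ξ → EndsIn P ξ' := by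
    intro k
    induction k with
    | zero =>
      intro z z' h1 hzA hk ξ ξ' hξ hξ' hPξ
      have hH := LabelledTree.isHalf_half h1
      have hemp : A ∩ T.half z z' = ∅ := by
        rwa [Nat.le_zero, Set.ncard_eq_zero (hAfin.inter_of_left _)] at hk
      have hnot : ∀ y ∈ T.half z z', y ∉ A := fun y hy hyA => by
        have : y ∈ (∅ : Set (Vert n R.V)) := hemp ▸ ⟨hyA, hy⟩
        exact this
      have hconst : ∀ y ∈ T.half z z', (y ∈ P ↔ z' ∈ P) := by
        have : {y | y ∈ T.half z z' ∧ ¬ (y ∈ P ↔ z' ∈ P)} = ∅ := by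
          refine LabelledTree.eq_empty_of_closed (T := T) (y := z) ?_ fun h => hH.1 h.1
          rintro y y' hy ⟨h2, h3⟩
          have h4 : y' ∈ T.half z z' := by
            by_contra h4
            have := (hH.2.2 _ _ (LabelledTree.Adj.symm hy) h4 h2).2
            exact h3 (by rw [this])
          exact ⟨h4, fun h5 => h3 ((hchA y y' hy (hnot y h2)).trans h5)⟩
        intro y hy
        by_contra h2
        have h3 : y ∈ (∅ : Set (Vert n R.V)) := this ▸ ⟨hy, h2⟩
        exact h3
      obtain ⟨i, h2, h3⟩ := (hξ.and hPξ).exists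
      have hz'P : z' ∈ P := (hconst _ (h2 v₀)).mp (h3 v₀)
      exact hξ'.mono fun y hy => (hconst y hy).mpr hz'P
    | succ k ih =>
      intro z z' h1 hzA hk ξ ξ' hξ hξ' hPξ
      by_contra hPξ'
      by_cases hz'A : z' ∈ A
      · have hrec : ∀ d, T.E d.1 z'.2 d.2 → nbrAt z' d ≠ z → ∀ ξ ξ',
            EndsIn (T.half z' (nbrAt z' d)) ξ → EndsIn (T.half z' (nbrAt z' d)) ξ' →
            EndsIn P ξ → EndsIn P ξ' := by
          intro d hd hdz
          have had := LabelledTree.adj_nbrAt hd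
          refine ih z' (nbrAt z' d) had hz'A ?_
          have hss : A ∩ T.half z' (nbrAt z' d) ⊂ A ∩ T.half z z' := by
            refine (Set.ssubset_iff_of_subset (Set.inter_subset_inter_right _
              (LabelledTree.half_subset h1 had hdz))).mpr ⟨z', ⟨hz'A,
                (LabelledTree.isHalf_half h1).2.1⟩, fun h => (LabelledTree.isHalf_half had).1 h.2⟩
          have := Set.ncard_lt_ncard hss (hAfin.inter_of_left _)
          omega
        obtain ⟨x, hx, hxz⟩ := LabelledTree.exists_nbrAt (LabelledTree.Adj.symm h1)
        have hne : ∀ d, d ≠ x → nbrAt z' d ≠ z := fun d hd h => by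
          rw [hxz] at h
          exact hd (LabelledTree.nbrAt_injective z' h)
        -- By induction each forward direction at `z'` is wholly inside or wholly outside `P`, and
        -- `X` collects the inside ones. If both kinds occur, `NoCut` with `x` pointing back to `z`
        -- gives a turn between them; the line realizing it would be separated by a translate of
        -- `P`.
        let X : Set (Letter n × R.V) := {d | T.E d.1 z'.2 d.2 ∧ nbrAt z' d ≠ z ∧
          ∃ ζ, EndsIn (T.half z' (nbrAt z' d)) ζ ∧ EndsIn P ζ}
        obtain ⟨d, hd, hdz, hdξ⟩ := LabelledTree.endsIn_half_step h1 hξ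
        obtain ⟨d', hd', hdz', hdξ'⟩ := LabelledTree.endsIn_half_step h1 hξ'
        obtain ⟨p, hp, hpp, hpv, hpX, hpX', hpx⟩ := hR z'.2 x X hx (fun h => h.2.1 hxz.symm)
          ⟨d, ⟨hd, hdz, ξ, hdξ, hPξ⟩, hd⟩
          ⟨d', fun ⟨_, _, ζ, h2, h3⟩ => hPξ' (hrec d' hd' hdz' ζ ξ' h2 hdξ' h3),
            fun h => hdz' (by rw [h, ← hxz]), hd'⟩
        obtain ⟨q, hq, hq1, hq2⟩ := hline p hp hpp
        have hE1 := R.map.edge_dir hp hpp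
        have hE2 := R.map.edge_dir_swap hp hpp
        rw [hpv] at hq1 hq2 hE1 hE2
        have hq1' := hq1.smul z'.1
        have hq2' := hq2.smul z'.1
        rw [← LabelledTree.half_nbrAt hE1] at hq1'
        rw [← LabelledTree.half_nbrAt hE2] at hq2'
        obtain ⟨-, hzz, ζ, h2, h3⟩ := hpX
        have h4 := hrec _ hE1 hzz _ _ h2 hq1' h3
        exact hpX' ⟨hE2, hne _ hpx, _, hq2', (hq z'.1).mp h4⟩
      · refine hPξ' (ih z z' h1 hzA ?_ ξ ξ' hξ hξ' hPξ)
        have hemp : A ∩ T.half z z' = ∅ := by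
          rw [Set.eq_empty_iff_forall_notMem]
          exact fun a ha => hz'A (hstep z z' h1 hzA ⟨a, ha⟩)
        rw [hemp, Set.ncard_empty]
        omega
  have hside : ∀ ξ ξ', EndsIn (T.half z₀ z₁) ξ → EndsIn (T.half z₀ z₁) ξ' →
      (EndsIn P ξ ↔ EndsIn P ξ') := fun ξ ξ' h h' =>
    ⟨hmono _ z₀ z₁ hadj hz₀A le_rfl ξ ξ' h h', hmono _ z₀ z₁ hadj hz₀A le_rfl ξ' ξ h' h⟩
  have hside' : ∀ ξ ξ', EndsIn (T.half z₁ z₀) ξ → EndsIn (T.half z₁ z₀) ξ' →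
      (EndsIn P ξ ↔ EndsIn P ξ') := fun ξ ξ' h h' =>
    have hadj' := LabelledTree.Adj.symm hadj
    ⟨hmono _ z₁ z₀ hadj' hz₁A le_rfl ξ ξ' h h', hmono _ z₁ z₀ hadj' hz₁A le_rfl ξ' ξ h' h⟩
  obtain ⟨q, hq, hq1, hq2⟩ := hline p₀ hp₀ hpp₀
  have hq12 : EndsIn P q.1 ↔ EndsIn P q.2 := by simpa using hq 1
  have hq2' : EndsIn (T.half z₁ z₀) q.2 := by
    refine hq2.mono ?_
    refine LabelledTree.half_subset (LabelledTree.Adj.symm hadj)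
      (adj_nbr (R.map.edge_dir_swap hp₀ hpp₀)) fun h => ?_
    refine R.map.dir_swap_ne hpp₀ (Prod.ext (gen_injective ?_) ?_)
    · exact (congrArg Prod.fst h).symm
    · exact (congrArg (fun y : Vert n R.V => y.2) h).symm
  -- `P` is constant on each side of the edge `z₀ z₁`, and the line `q` has an end on each side.
  have hall : ∀ ξ, EndsIn P ξ ↔ EndsIn P q.1 := by
    intro ξ
    by_cases h : EndsIn (T.half z₀ z₁) ξ
    · exact hside ξ q.1 h hq1
    · have : Nonempty R.V := ⟨v₀⟩
      rw [← (LabelledTree.almostInvariant (LabelledTree.isHalf_half hadj)).endsIn_compl,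
        ← LabelledTree.half_symm hadj] at h
      exact (hside' ξ q.2 h hq2').trans hq12.symm
  exact (hall ξ).trans (hall ξ').symm

/-! ### Neighbourhoods of lines -/

/-- The saturation of an open set is a union of its preimages under translations and the
interchange, which are continuous. -/
theorem isOpenMap_line_mk : IsOpenMap (Line.mk : EndpointPair n → Line n) := by
  intro O hO
  have hsm : ∀ g : FreeGroup (Fin n), Continuous fun q : EndpointPair n =>
      (⟨g • q.1, fun h => q.2 (smul_left_cancel g h)⟩ : EndpointPair n) := fun g =>
    Continuous.subtype_mk (((continuous_const_smul g).comp continuous_fst).prodMk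
      ((continuous_const_smul g).comp continuous_snd) |>.comp continuous_subtype_val) _
  have hsw : Continuous fun q : EndpointPair n => (⟨q.1.swap, q.2.symm⟩ : EndpointPair n) :=
    Continuous.subtype_mk (continuous_swap.comp continuous_subtype_val) _
  change IsOpen (Line.mk ⁻¹' (Line.mk '' O))
  have : Line.mk ⁻¹' (Line.mk '' O) = ⋃ g : FreeGroup (Fin n),
      (fun q : EndpointPair n =>
        (⟨g • q.1, fun h => q.2 (smul_left_cancel g h)⟩ : EndpointPair n)) ⁻¹'
        (O ∪ (fun q : EndpointPair n => (⟨q.1.swap, q.2.symm⟩ : EndpointPair n)) ⁻¹' O) := by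
    ext q
    simp only [Set.mem_preimage, Set.mem_image, Set.mem_iUnion, Set.mem_union]
    constructor
    · rintro ⟨o, ho, h⟩
      obtain ⟨g, hg | hg⟩ := Quotient.exact (s := lineSetoid n) h.symm
      · refine ⟨g, Or.inl ?_⟩
        have : (⟨g • q.1, fun h => q.2 (smul_left_cancel g h)⟩ : EndpointPair n) = o :=
          Subtype.ext hg
        rwa [this]
      · refine ⟨g, Or.inr ?_⟩
        have : (⟨(g • q.1).swap, fun h => q.2 (smul_left_cancel g h.symm)⟩ : EndpointPair n) = o :=
          Subtype.ext ((congrArg Prod.swap hg).trans (Prod.swap_swap _))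
        rw [← this] at ho
        exact ho
    · rintro ⟨g, h | h⟩
      · exact ⟨_, h, line_mk_smul g q.1 q.2 _⟩
      · refine ⟨_, h, ?_⟩
        exact (line_mk_swap (g • q.1) (fun h => q.2 (smul_left_cancel g h)) _).trans
          (line_mk_smul g q.1 q.2 _)
  rw [this]
  exact isOpen_iUnion fun g => (hO.union (hO.preimage hsw)).preimage (hsm g)

/-- The lines near `b` that realize every turn of the lift of `b` to the resolution. -/
def Resolution.turnNhd {B : Set (Line n)} (R : Resolution n B) (b : Line n) : Set (Line n) :=
  {ℓ | ∀ τ : R.V × (Letter n × R.V) × (Letter n × R.V),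
    (∃ p ∈ lifts {b}, Pointed p ∧ R.map.lam p = τ.1 ∧ R.map.dir p = τ.2.1 ∧
      R.map.dir p.swap = τ.2.2) →
    ∃ q : EndpointPair n, Line.mk q = ℓ ∧ EndsIn (R.tree.half (1, τ.1) (nbr τ.2.1)) q.1.1 ∧
      EndsIn (R.tree.half (1, τ.1) (nbr τ.2.2)) q.1.2}

theorem Resolution.turnNhd_mem_nhds {B : Set (Line n)} (R : Resolution n B) [Nonempty R.V]
    {b : Line n} (hb : b ∈ B) : R.turnNhd b ∈ 𝓝 b := by
  -- A line has infinitely many pointed lifts, but only finitely many turns `τ` in the finite graph.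
  refine eventually_all.mpr fun τ => ?_
  by_cases hτ : ∃ p ∈ lifts {b}, Pointed p ∧ R.map.lam p = τ.1 ∧ R.map.dir p = τ.2.1 ∧
      R.map.dir p.swap = τ.2.2
  · obtain ⟨p, ⟨hne, rfl⟩, hpp, h1, h2, h3⟩ := hτ
    have hp : p ∈ lifts B := ⟨hne, hb⟩
    have e1 := R.map.endsIn_half hp hpp
    have e2 := R.map.endsIn_half_swap hp hpp
    have f1 := R.map.edge_dir hp hpp
    have f2 := R.map.edge_dir_swap hp hpp
    rw [h1, h2] at e1 f1
    rw [h1, h3] at e2 f2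
    obtain ⟨N₁, hN₁⟩ := (LabelledTree.almostInvariant
      (LabelledTree.isHalf_half (adj_nbr f1))).endsIn_congr
    obtain ⟨N₂, hN₂⟩ := (LabelledTree.almostInvariant
      (LabelledTree.isHalf_half (adj_nbr f2))).endsIn_congr
    have hO : IsOpen {q : EndpointPair n | (∀ i < N₁, q.1.1.1 i = p.1.1 i) ∧
        ∀ i < N₂, q.1.2.1 i = p.2.1 i} :=
      ((isOpen_cylinder p.1 N₁).preimage (continuous_fst.comp continuous_subtype_val)).inter
        ((isOpen_cylinder p.2 N₂).preimage (continuous_snd.comp continuous_subtype_val))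
    have hmem := (isOpenMap_line_mk _ hO).mem_nhds
      ⟨(⟨p, hne⟩ : EndpointPair n), ⟨fun _ _ => rfl, fun _ _ => rfl⟩, rfl⟩
    filter_upwards [hmem]
    rintro _ ⟨q, hq, rfl⟩ -
    exact ⟨q, rfl, (hN₁ p.1 q.1.1 hq.1).mpr e1, (hN₂ p.2 q.1.2 hq.2).mpr e2⟩
  · exact Eventually.of_forall fun ℓ h => (hτ h).elim

theorem not_mem_boundaryOf_bot (c : ConjAct (FreeGroup (Fin n))) (ξ : Boundary n) :
    ξ ∉ boundaryOf (c • (⊥ : Subgroup (FreeGroup (Fin n)))) := by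
  intro h
  obtain ⟨a, ha, hpre⟩ := h 1
  rw [Subgroup.smul_bot, Subgroup.mem_bot] at ha
  rw [ha, FreeGroup.toWord_one] at hpre
  simpa using hpre.length_le

end FreeLines

/-! ### The proposition -/

theorem mainTheorem9 (n : ℕ) (hn : 2 ≤ n) (B₁ B₂ : Set (FreeLines.Line n))
    (hB₁ : FreeLines.IsFilling B₁) (hB₂ : FreeLines.IsFilling B₂)
    (hdisj : closure B₁ ∩ closure B₂ = ∅) :
    ∃ U : FreeLines.Line n → Set (FreeLines.Line n),
      (∀ b ∈ B₁ ∪ B₂, U b ∈ nhds b) ∧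
      ∀ F : Subgroup (FreeGroup (Fin n)), FreeLines.IsFreeFactor F ⊤ → F ≠ ⊤ →
        ∃ b ∈ B₁ ∪ B₂, ∀ ℓ ∈ U b, ¬ FreeLines.Carries {FreeLines.conjClass F} ℓ := by
  open FreeLines in
  obtain ⟨R, hR⟩ := exists_noCut hn hB₁ hB₂ hdisj
  obtain ⟨b₀, hb₀⟩ := hB₁.nonempty.mono (Set.subset_union_left (t := B₂))
  obtain ⟨p₀, -⟩ := exists_pointed_mem_lifts hb₀
  have : Nonempty R.V := ⟨R.map.lam p₀⟩
  refine ⟨R.turnNhd, fun b hb => R.turnNhd_mem_nhds hb, fun F ⟨C, hFC⟩ hF => ?_⟩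
  -- The trivial free factor has empty boundary and carries no line, so any `b` serves.
  by_cases hbot : F = ⊥
  · refine ⟨b₀, hb₀, fun ℓ _ => ?_⟩
    rintro ⟨A, hA, p, -, hp, -⟩
    obtain ⟨c, rfl⟩ := conjClass_eq_iff.mp hA
    rw [hbot] at hp
    exact not_mem_boundaryOf_bot c _ hp
  have hC : C ≠ ⊥ := by
    rintro rfl
    apply hF
    rw [eq_top_iff, ← hFC.2]
    rw [Monoid.CoprodI.range_eq_iSup]
    refine iSup_le fun i => ?_
    rw [Subgroup.range_subtype]
    fin_cases i
    · exact le_rfl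
    · exact bot_le
  by_contra! hcon
  obtain ⟨f, hfF, hfin, hf0, hf1⟩ := exists_almostInvariant hFC
  have hP := almostInvariant_of_fun (V := R.V) hfin
  have hline : ∀ p ∈ lifts (B₁ ∪ B₂), Pointed p → ∃ q : Boundary n × Boundary n,
      (∀ g : FreeGroup (Fin n), EndsIn ({z | f z.1 = 1} : Set (Vert n R.V)) (g • q.1) ↔
        EndsIn ({z | f z.1 = 1} : Set (Vert n R.V)) (g • q.2)) ∧
      EndsIn (R.tree.half (1, R.map.lam p) (nbr (R.map.dir p))) q.1 ∧
      EndsIn (R.tree.half (1, R.map.lam p) (nbr (R.map.dir p.swap))) q.2 := by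
    rintro p ⟨hne, hb⟩ hpp
    obtain ⟨ℓ, hℓ, A, hA, r, rfl, hr1, hr2⟩ := hcon _ hb
    obtain ⟨q, hq, hq1, hq2⟩ := hℓ (R.map.lam p, R.map.dir p, R.map.dir p.swap)
      ⟨p, ⟨hne, rfl⟩, hpp, rfl, rfl, rfl⟩
    refine ⟨q.1, fun g => ?_, hq1, hq2⟩
    obtain ⟨c, rfl⟩ := conjClass_eq_iff.mp hA
    have key : ∀ h : FreeGroup (Fin n),
        EndsIn ({z | f z.1 = 1} : Set (Vert n R.V)) (h • r.1.1) ↔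
          EndsIn ({z | f z.1 = 1} : Set (Vert n R.V)) (h • r.1.2) := fun h =>
      (endsIn_of_mem_boundaryOf hfin hfF c hr1 h).trans
        (endsIn_of_mem_boundaryOf hfin hfF c hr2 h).symm
    -- The lift `q` that realizes the turn and the lift `r` with ends in `∂A` differ by a
    -- translation and perhaps a flip; the condition on `P` ranges over all translates and is
    -- symmetric in the ends.
    obtain ⟨h, hh | hh⟩ := Quotient.exact (s := lineSetoid n) hq.symm
    · rw [← hh]
      have := key (g * h)
      rwa [mul_smul, mul_smul] at this
    · rw [← Prod.swap_swap q.1, ← hh]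
      have := (key (g * h)).symm
      rwa [mul_smul, mul_smul] at this
  -- `f` is `1` on the nontrivial elements of `C` and `0` on `F`; both sets are infinite, so `P` has
  -- ends inside and outside.
  obtain ⟨ξ, hξ⟩ := exists_endsIn (V := R.V) hP (S := (C : Set _) \ {1})
    ((infinite_of_ne_bot hC).sdiff (Set.finite_singleton 1)) fun g hg u => hf1 g hg.1 hg.2
  obtain ⟨ξ', hξ'⟩ := exists_endsIn (V := R.V) hP.compl (S := (F : Set _))
    (infinite_of_ne_bot hbot) fun g hg u h => by
      have h1 : f g = 1 := h
      rw [hf0 g hg] at h1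
      exact zero_ne_one h1
  exact (hP.endsIn_compl ξ').mp hξ' ((hR.endsIn_iff hP hline ξ ξ').mp hξ)
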